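/- Let $\mathcal U,\mathcal X,\mathcal Z$ be finite alphabets, $p(u,x)$ a probability mass function on $\mathcal U\times\mathcal X$ with marginals $p(u)=p_U(u)$, $p(x)=p_X(x)$, and $p(z|x)=p_{Z|X}(z|x)$ a channel from $\mathcal X$ to $\mathcal Z$. Put $p(z)=\sum_x p(x)p(z|x)$ and $q(z^n)=\prod_{i=1}^n p(z_i)$. All logarithms are in base two. For $\epsilon>0$ and $n\ge 1$ let $$\mathcal T^n_\epsilon(p_U)=\Big\{u^n:\Big|\tfrac1n\sum_{i=1}^n\mathbf 1\{u_i=u\}-p(u)\Big|<\epsilon\ \ \forall u\Big\},$$ $$\mathcal T^n_\epsilon(X|u^n)=\Big\{x^n:\Big|\tfrac1n\sum_{i=1}^n\mathbf 1\{(x_i,u_i)=(x,u)\}-p(u,x)\Big|<2\epsilon\ \ \forall (u,x)\Big\},$$ and let $(U^n,X^n)$ be distributed over the jointly typical set $\{(u^n,x^n):u^n\in\mathcal T^n_\epsilon(p_U),\,x^n\in\mathcal T^n_\epsilon(X|u^n)\}$ according to $$\tilde p(u^n,x^n)=\frac{\prod_{i=1}^n p(u_i)p(x_i|u_i)}{\Big(\sum_{v^n\in\mathcal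 T^n_\epsilon(p_U)}\prod_{i=1}^n p(v_i)\Big)\Big(\sum_{y^n\in\mathcal T^n_\epsilon(X|u^n)}\prod_{i=1}^n p(y_i|u_i)\Big)}$$ (for fixed $\epsilon$ this is well defined for all large $n$; it is $0$ if some $p(u_i)=0$). Let $X^n$ be sent through the memoryless channel, so that $(U^n,X^n,Z^n)$ has the law $\tilde p(u^n,x^n)\prod_{i=1}^n p(z_i|x_i)$. Let $R\ge0$, $M=\lfloor 2^{nR}\rfloor$, and let $\mathcal B:\mathcal U^n\to[M]=\{1,\dots,M\}$ be a random binning: every $u^n$ is mapped to a bin independently and uniformly. Given $\mathcal B$, let $$P(b,z^n)=\sum_{u^n,x^n}\tilde p(u^n,x^n)\,\mathbf 1\{\mathcal B(u^n)=b\}\prod_{i=1}^n p(z_i|x_i),$$ and let $p^U(b)=1/M$. For $\alpha>1$ let $T_\alpha(P\|Q)=\frac1{\alpha-1}\big(\sum_a P(a)^\alpha Q(a)^{1-\alpha}-1\big)$ (here always applied to $P$ absolutely continuous with respect to $Q$, terms with $P(a)=Q(a)=0$ being $0$). Let $H(U)=-\sum_u p(u)\log p(u)$ and $$R'_\alpha(p_X,p_{Z|X},p_U)=\max_{t_{Z|XU}}\Big[-\frac{\alpha}{\alpha-1}D\big(t(z|u,x)\,\|\,p(z|x)\,\big|\,p(u,x)\big)+D\big(t(z|u)\,\|\,p(z)\,\big|\,p(u)\big)\Big],$$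 where $D(a(\cdot|s)\|b(\cdot|s)\,|\,w(s))=\sum_s w(s)\sum_z a(z|s)\log\frac{a(z|s)}{b(z|s)}$ is the conditional Kullback--Leibler divergence, the maximum is over all conditional probability mass functions $t(z|u,x)$ for which the first divergence is finite, and $t(z|u)=\sum_x p(x|u)t(z|u,x)$ is the conditional law of $Z$ given $U$ under $p(u,x)t(z|u,x)$. If $$R<H(U)-R'_\alpha(p_X,p_{Z|X},p_U),$$ then there is $\epsilon_0>0$ such that for every $\epsilon\in(0,\epsilon_0)$ $$\lim_{n\to\infty}\mathbb E_{\mathcal B}\Big[T_\alpha\big(P(b,z^n)\,\big\|\,p^U(b)\,q(z^n)\big)\Big]=0 .$$ -/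

import Mathlib

open Filter Topology

namespace StochasticBinning

noncomputable section

/-! Probability mass functions on a finite alphabet `A` are real functions in `stdSimplex ℝ A`, channels
from `A` to `B` are functions `A → B → ℝ` all of whose rows lie in `stdSimplex ℝ B`, and sequences of
length `n` are functions `Fin n → A`.  Logarithms are in base two. -/

/-- Shannon entropy `H(p) = -∑ p(a) log₂ p(a)`. -/
def entropy {A : Type*} [Fintype A] (p : A → ℝ) : ℝ :=
  -∑ a, p a * Real.logb 2 (p a)

/-- Kullback-Leibler divergence `D(p ‖ q)`, for `p` absolutely continuous with respect to `q`
(the only case in which it is used below). -/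
def klDiv {A : Type*} [Fintype A] (p q : A → ℝ) : ℝ :=
  ∑ a, p a * Real.logb 2 (p a / q a)

/-- Conditional divergence `D(p(·|s) ‖ q(·|s) | w) = ∑ₛ w(s) D(p(·|s) ‖ q(·|s))`. -/
def condKlDiv {S A : Type*} [Fintype S] [Fintype A] (p q : S → A → ℝ) (w : S → ℝ) : ℝ :=
  ∑ s, w s * klDiv (p s) (q s)

/-- Tsallis divergence of order `α`, for `p` absolutely continuous with respect to `q`
(terms with `q a = 0 = p a` vanish). -/
def tsallisDiv {A : Type*} [Fintype A] (α : ℝ) (p q : A → ℝ) : ℝ :=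
  1 / (α - 1) * (∑ a, p a ^ α * q a ^ (1 - α) - 1)

variable {𝒰 𝒳 𝒵 : Type*} [Fintype 𝒰] [Fintype 𝒳] [Fintype 𝒵]

/-- The marginal `p(u)` of the joint pmf `p(u,x)`. -/
def margU (p : 𝒰 × 𝒳 → ℝ) (u : 𝒰) : ℝ := ∑ x, p (u, x)

/-- The marginal `p(x)` of the joint pmf `p(u,x)`. -/
def margX (p : 𝒰 × 𝒳 → ℝ) (x : 𝒳) : ℝ := ∑ u, p (u, x)

/-- The conditional pmf `p(x|u)`; it is only ever used with a factor `p(u)`. -/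
def condXU (p : 𝒰 × 𝒳 → ℝ) (u : 𝒰) (x : 𝒳) : ℝ := p (u, x) / margU p u

/-- The output pmf `p(z) = ∑ₓ p(x) p(z|x)` of the channel `W = p(z|x)`. -/
def outZ (p : 𝒰 × 𝒳 → ℝ) (W : 𝒳 → 𝒵 → ℝ) (z : 𝒵) : ℝ := ∑ x, margX p x * W x z

/-- The conditional pmf `t(z|u) = ∑ₓ p(x|u) t(z|u,x)` in the joint law `t(u,x,z) = p(u,x) t(z|u,x)`,
the one whose `(U,X)`-marginal is `p(u,x)`. -/
def condZU (p : 𝒰 × 𝒳 → ℝ) (t : 𝒰 × 𝒳 → 𝒵 → ℝ) (u : 𝒰) (z : 𝒵) : ℝ :=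
  ∑ x, condXU p u x * t (u, x) z

/-- The conditional pmfs `t(z|u,x)` for which `D(t(z|u,x) ‖ p(z|x) | p(u,x))` is finite.  For all others
the objective of the maximum below is `-∞`; for these `D(t(z|u) ‖ p(z) | p(u))` is finite as well. -/
def auxChannels (p : 𝒰 × 𝒳 → ℝ) (W : 𝒳 → 𝒵 → ℝ) : Set (𝒰 × 𝒳 → 𝒵 → ℝ) :=
  {t | (∀ s, t s ∈ stdSimplex ℝ 𝒵) ∧ ∀ u x z, p (u, x) ≠ 0 → W x z = 0 → t (u, x) z = 0}

/-- The quantity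
`R'_α = max_t [-(α/(α-1)) D(t(z|u,x) ‖ p(z|x) | p(u,x)) + D(t(z|u) ‖ p(z) | p(u))]`. -/
def auxRate (α : ℝ) (p : 𝒰 × 𝒳 → ℝ) (W : 𝒳 → 𝒵 → ℝ) : ℝ :=
  sSup ((fun t : 𝒰 × 𝒳 → 𝒵 → ℝ =>
      -(α / (α - 1)) * condKlDiv t (fun s => W s.2) p
        + condKlDiv (condZU p t) (fun _ => outZ p W) (margU p)) '' auxChannels p W)

open Classical in
/-- The relative frequency of the letter `a` in the sequence `s`. -/
def freq {A : Type*} {n : ℕ} (s : Fin n → A) (a : A) : ℝ :=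
  (∑ i, if s i = a then 1 else 0) / n

/-- The typical set of sequences `uⁿ`. -/
def typicalU (p : 𝒰 × 𝒳 → ℝ) (ε : ℝ) (n : ℕ) : Set (Fin n → 𝒰) :=
  {u | ∀ a, |freq u a - margU p a| < ε}

/-- The set of sequences `xⁿ` that are conditionally typical given `uⁿ`. -/
def typicalX (p : 𝒰 × 𝒳 → ℝ) (ε : ℝ) {n : ℕ} (u : Fin n → 𝒰) : Set (Fin n → 𝒳) :=
  {x | ∀ a b, |freq (fun i => (u i, x i)) (a, b) - p (a, b)| < 2 * ε}

open Classical in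
/-- The pmf `p̃(uⁿ,xⁿ)` on the jointly typical set, extended by zero. -/
def typicalPMF (p : 𝒰 × 𝒳 → ℝ) (ε : ℝ) (n : ℕ) (u : Fin n → 𝒰) (x : Fin n → 𝒳) : ℝ :=
  if u ∈ typicalU p ε n ∧ x ∈ typicalX p ε u then
    (∏ i, margU p (u i) * condXU p (u i) (x i)) /
      ((∑ v : Fin n → 𝒰, if v ∈ typicalU p ε n then ∏ i, margU p (v i) else 0) *
        (∑ y : Fin n → 𝒳, if y ∈ typicalX p ε u then ∏ i, condXU p (u i) (y i) else 0))
  else 0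

open Classical in
/-- The pmf `P(b,zⁿ)` of bin index and channel output that is induced by the binning `B`. -/
def binnedLaw (p : 𝒰 × 𝒳 → ℝ) (W : 𝒳 → 𝒵 → ℝ) (ε : ℝ) {n M : ℕ}
    (B : (Fin n → 𝒰) → Fin M) (bz : Fin M × (Fin n → 𝒵)) : ℝ :=
  ∑ u : Fin n → 𝒰, ∑ x : Fin n → 𝒳,
    typicalPMF p ε n u x * (if B u = bz.1 then 1 else 0) * ∏ i, W (x i) (bz.2 i)

/-- The pmf `p^U(b) q(zⁿ)`, with `p^U` uniform on the `M` bins and `q(zⁿ) = ∏ p(zᵢ)`. -/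
def idealLaw (p : 𝒰 × 𝒳 → ℝ) (W : 𝒳 → 𝒵 → ℝ) {n M : ℕ} (bz : Fin M × (Fin n → 𝒵)) : ℝ :=
  1 / M * ∏ i, outZ p W (bz.2 i)

open Classical in
/-- The expectation of `f B` when the sequences are mapped to `M` bins independently and uniformly. -/
def binningExp (𝒰 : Type*) [Fintype 𝒰] (n M : ℕ) (f : ((Fin n → 𝒰) → Fin M) → ℝ) : ℝ :=
  ∑ B : (Fin n → 𝒰) → Fin M, (∏ _u : Fin n → 𝒰, (1 / M : ℝ)) * f B

/-- `P(b,zⁿ)` is always absolutely continuous with respect to `p^U(b) q(zⁿ)`. -/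
theorem binnedLaw_eq_zero {p : 𝒰 × 𝒳 → ℝ} (hp : p ∈ stdSimplex ℝ (𝒰 × 𝒳)) {W : 𝒳 → 𝒵 → ℝ}
    (hW : ∀ x, W x ∈ stdSimplex ℝ 𝒵) (ε : ℝ) {n M : ℕ} (B : (Fin n → 𝒰) → Fin M)
    (bz : Fin M × (Fin n → 𝒵)) (h : idealLaw p W bz = 0) : binnedLaw p W ε B bz = 0 := by
  have hM : (M : ℝ) ≠ 0 := by
    have := bz.1.pos
    positivity
  unfold idealLaw at h
  obtain ⟨i, -, hi⟩ := Finset.prod_eq_zero_iff.1 ((mul_eq_zero.1 h).resolve_left (by simpa using hM))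
  have hX : ∀ x, 0 ≤ margX p x := fun x => Finset.sum_nonneg fun u _ => hp.1 _
  refine Finset.sum_eq_zero fun u _ => Finset.sum_eq_zero fun x _ => ?_
  have h1 := (Finset.sum_eq_zero_iff_of_nonneg
    (fun x _ => mul_nonneg (hX x) ((hW x).1 (bz.2 i)))).1 hi (x i) (Finset.mem_univ _)
  rcases mul_eq_zero.1 h1 with h2 | h2
  · have h3 := (Finset.sum_eq_zero_iff_of_nonneg (fun u _ => hp.1 (u, x i))).1 h2 (u i)
      (Finset.mem_univ _)
    have h4 : ∏ j, margU p (u j) * condXU p (u j) (x j) = 0 :=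
      Finset.prod_eq_zero (Finset.mem_univ i) (by simp [condXU, h3])
    simp [typicalPMF, h4]
  · rw [Finset.prod_eq_zero (Finset.mem_univ i) h2, mul_zero]

end

end StochasticBinning

/-! Write `1 + (α - 1) T_α` as a power sum, so that only the expected `α`-th moments of bin masses
matter. Fix a bin `b` and an output `z`, let `a u` be the joint mass of `u` and `z`, and let `S` be
the sum of `a u` over the `u` binned to `b`. In `S ^ α = ∑ a u 1{B u = b} S ^ (α - 1)` each `S` is
`a u + T`, with `T` independent of the bin of `u`. The inequality `(x + y) ^ s ≤ (1 + δ) y ^ s + C x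
^ s` separates the two. Young's inequality lets the remaining `(α - 1)`-th moment be absorbed on the
left (`sum_bin_rpow_le`). No case distinction on `α` is needed.

Summed against the ideal law (`sum_binned_rpow_le`), this leaves two terms. The first is `1 + δ`
times the power sum of the unbinned output law, which is dominated by `q` up to a factor tending to
one. The second is a constant times `M ^ (α - 1) ∑ a u z ^ α q z ^ (1 - α)` and must decay.

For the second term, fix `u` and split its output measure by the joint type of `(u, x, z)`. There
are polynomially many types, and for each a change of measure to the type's own conditional law `t`
gives the objective of the maximum as exponent (`sum_typeMass_rpow_le`). The `(u, x)`-type lies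
within `2ε` of `p`, so the exponent is at most `(α - 1) R'_α + O(ε)` (`exists_exponent_le`). The
factor `p(u) ^ (α - 1)` contributes `-(α - 1) H(U)`, and `M ^ (α - 1)` at most `(α - 1) R`, so the
hypothesis on `R` makes the total negative for small `ε`. Nonnegativity of `T_α` gives the other
half of the limit. -/

namespace StochasticBinning

/-! ### Chebyshev bounds for independent letters -/

section Concentration

variable {A : Type*} [Fintype A] {n : ℕ}

theorem sum_prod_pi (g : Fin n → A → ℝ) :
    ∑ y : Fin n → A, ∏ i, g i (y i) = ∏ i, ∑ a, g i a := by
  rw [Finset.prod_univ_sum, Fintype.piFinset_univ]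

theorem sum_prod_simplex (r : Fin n → A → ℝ) (hr : ∀ i, r i ∈ stdSimplex ℝ A) :
    ∑ y : Fin n → A, ∏ i, r i (y i) = 1 := by
  rw [sum_prod_pi, Finset.prod_congr rfl fun i _ => (hr i).2, Finset.prod_const_one]

/-- The second moment of a sum of independent centred variables bounded by one. -/
theorem second_moment_le (r : Fin n → A → ℝ) (hr : ∀ i, r i ∈ stdSimplex ℝ A)
    (h : Fin n → A → ℝ) (h0 : ∀ i, ∑ a, r i a * h i a = 0) (h1 : ∀ i a, |h i a| ≤ 1) :
    ∑ y : Fin n → A, (∏ i, r i (y i)) * (∑ i, h i (y i)) ^ 2 ≤ n := by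
  have hpos : ∀ y : Fin n → A, 0 ≤ ∏ i, r i (y i) := fun y =>
    Finset.prod_nonneg fun i _ => (hr i).1 _
  have hcross : ∀ i j, i ≠ j →
      ∑ y : Fin n → A, (∏ k, r k (y k)) * (h i (y i) * h j (y j)) = 0 := by
    intro i j hij
    -- As a product over coordinates the expectation factorises, and the factor at `i` is the mean
    -- of `h i`, which is zero.
    have : ∀ y : Fin n → A, (∏ k, r k (y k)) * (h i (y i) * h j (y j)) =
        ∏ k, (r k (y k) * ((if k = i then h k (y k) else 1) *
          (if k = j then h k (y k) else 1))) := by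
      intro y
      rw [Finset.prod_mul_distrib, Finset.prod_mul_distrib]
      simp
    simp_rw [this]
    rw [sum_prod_pi (fun k a => r k a * ((if k = i then h k a else 1) *
          (if k = j then h k a else 1)))]
    refine Finset.prod_eq_zero (Finset.mem_univ i) ?_
    simpa [hij] using h0 i
  have hdiag : ∀ i, ∑ y : Fin n → A, (∏ k, r k (y k)) * (h i (y i) * h i (y i)) ≤ 1 := by
    intro i
    rw [← sum_prod_simplex r hr]
    refine Finset.sum_le_sum fun y _ => mul_le_of_le_one_right (hpos y) ?_
    rw [← abs_mul_abs_self]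
    exact mul_le_one₀ (h1 _ _) (abs_nonneg _) (h1 _ _)
  calc ∑ y : Fin n → A, (∏ i, r i (y i)) * (∑ i, h i (y i)) ^ 2
      = ∑ i, ∑ j, ∑ y : Fin n → A, (∏ k, r k (y k)) * (h i (y i) * h j (y j)) := by
        simp_rw [sq, Finset.sum_mul_sum, Finset.mul_sum]
        rw [Finset.sum_comm]
        exact Finset.sum_congr rfl fun i _ => Finset.sum_comm
    _ = ∑ i, ∑ y : Fin n → A, (∏ k, r k (y k)) * (h i (y i) * h i (y i)) :=
        Finset.sum_congr rfl fun i _ =>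
          Finset.sum_eq_single i (fun j _ hj => hcross i j hj.symm) (by simp)
    _ ≤ ∑ _i : Fin n, (1 : ℝ) := Finset.sum_le_sum fun i _ => hdiag i
    _ = n := by simp

open Classical in
/-- Chebyshev's inequality and the union bound for sums of independent variables. -/
theorem one_sub_le_sum_of_deviation {ι : Type*} [Fintype ι] (hn : 0 < n) {ε : ℝ} (hε : 0 < ε)
    (r : Fin n → A → ℝ) (hr : ∀ i, r i ∈ stdSimplex ℝ A) (f : ι → Fin n → A → ℝ)
    (hf : ∀ k i a, f k i a ∈ Set.Icc (0 : ℝ) 1) (S : Set (Fin n → A))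
    (hS : ∀ y : Fin n → A,
      (∀ k, |∑ i, (f k i (y i) - ∑ a, r i a * f k i a)| < n * ε) → y ∈ S) :
    1 - Fintype.card ι / (n * ε ^ 2) ≤ ∑ y : Fin n → A, if y ∈ S then ∏ i, r i (y i) else 0 := by
  have hn' : (0 : ℝ) < n := by exact_mod_cast hn
  have hpos : ∀ y : Fin n → A, 0 ≤ ∏ i, r i (y i) := fun y =>
    Finset.prod_nonneg fun i _ => (hr i).1 _
  set h : ι → Fin n → A → ℝ := fun k i a => f k i a - ∑ a, r i a * f k i a with hh
  have h0 : ∀ k i, ∑ a, r i a * h k i a = 0 := by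
    intro k i
    simp only [hh, mul_sub, Finset.sum_sub_distrib, ← Finset.sum_mul, (hr i).2, one_mul, sub_self]
  have h1 : ∀ k i a, |h k i a| ≤ 1 := by
    intro k i a
    have hm0 : 0 ≤ ∑ a, r i a * f k i a :=
      Finset.sum_nonneg fun a _ => mul_nonneg ((hr i).1 a) (hf k i a).1
    have hm1 : ∑ a, r i a * f k i a ≤ 1 := by
      rw [← (hr i).2]
      exact Finset.sum_le_sum fun a _ => mul_le_of_le_one_right ((hr i).1 a) (hf k i a).2
    have := hf k i a
    rw [abs_le]
    constructor <;> simp only [hh] <;> linarith [this.1, this.2]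
  -- Outside `S` some normalised squared deviation is at least one; summing this pointwise bound is
  -- Chebyshev and the union bound together.
  have hpt : ∀ y : Fin n → A, ∏ i, r i (y i) ≤ (if y ∈ S then ∏ i, r i (y i) else 0) +
      ∑ k, ((∏ i, r i (y i)) * (∑ i, h k i (y i)) ^ 2) / (n * ε) ^ 2 := by
    intro y
    have hnn : ∀ k ∈ Finset.univ,
        0 ≤ ((∏ i, r i (y i)) * (∑ i, h k i (y i)) ^ 2) / (n * ε) ^ 2 := fun k _ =>
      div_nonneg (mul_nonneg (hpos y) (sq_nonneg _)) (sq_nonneg _)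
    by_cases hy : y ∈ S
    · rw [if_pos hy]
      linarith [Finset.sum_nonneg hnn]
    · rw [if_neg hy, zero_add]
      have : ∃ k, n * ε ≤ |∑ i, h k i (y i)| := by
        by_contra! hc
        exact hy (hS y hc)
      obtain ⟨k, hk⟩ := this
      refine le_trans ?_ (Finset.single_le_sum hnn (Finset.mem_univ k))
      rw [le_div_iff₀ (by positivity)]
      refine mul_le_mul_of_nonneg_left ?_ (hpos y)
      rw [← sq_abs (∑ i, h k i (y i))]
      exact pow_le_pow_left₀ (by positivity) hk 2
  have hsum := Finset.sum_le_sum fun y (_ : y ∈ Finset.univ) => hpt y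
  rw [sum_prod_simplex r hr, Finset.sum_add_distrib, Finset.sum_comm] at hsum
  have hk : ∀ k, ∑ y : Fin n → A, ((∏ i, r i (y i)) * (∑ i, h k i (y i)) ^ 2) / (n * ε) ^ 2
      ≤ 1 / (n * ε ^ 2) := by
    intro k
    rw [← Finset.sum_div]
    calc _ ≤ (n : ℝ) / (n * ε) ^ 2 :=
          div_le_div_of_nonneg_right (second_moment_le r hr (h k) (h0 k) (h1 k)) (sq_nonneg _)
      _ = 1 / (n * ε ^ 2) := by field_simp
  have := Finset.sum_le_sum fun k (_ : k ∈ Finset.univ) => hk k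
  rw [Finset.sum_const, Finset.card_univ, nsmul_eq_mul] at this
  have e : (Fintype.card ι : ℝ) * (1 / (n * ε ^ 2)) = Fintype.card ι / (n * ε ^ 2) := by ring
  linarith

end Concentration

/-! ### Probability of the typical sets -/

section Typical

variable {𝒰 𝒳 𝒵 : Type*} [Fintype 𝒰] [Fintype 𝒳] [Fintype 𝒵] {p : 𝒰 × 𝒳 → ℝ} {n : ℕ}

theorem margU_nonneg (hp : p ∈ stdSimplex ℝ (𝒰 × 𝒳)) (u : 𝒰) : 0 ≤ margU p u :=
  Finset.sum_nonneg fun _ _ => hp.1 _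

theorem margU_mem (hp : p ∈ stdSimplex ℝ (𝒰 × 𝒳)) : margU p ∈ stdSimplex ℝ 𝒰 :=
  ⟨margU_nonneg hp, by rw [← hp.2, Fintype.sum_prod_type]; rfl⟩

theorem condXU_nonneg (hp : p ∈ stdSimplex ℝ (𝒰 × 𝒳)) (u : 𝒰) (x : 𝒳) : 0 ≤ condXU p u x :=
  div_nonneg (hp.1 _) (margU_nonneg hp u)

theorem condXU_mem (hp : p ∈ stdSimplex ℝ (𝒰 × 𝒳)) {u : 𝒰} (hu : margU p u ≠ 0) :
    condXU p u ∈ stdSimplex ℝ 𝒳 :=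
  ⟨condXU_nonneg hp u, by
    simp only [condXU, ← Finset.sum_div]
    exact div_self hu⟩

theorem margU_mul_condXU (hp : p ∈ stdSimplex ℝ (𝒰 × 𝒳)) (u : 𝒰) (x : 𝒳) :
    margU p u * condXU p u x = p (u, x) := by
  by_cases hu : margU p u = 0
  · rw [hu, zero_mul]
    exact ((Finset.sum_eq_zero_iff_of_nonneg fun x _ => hp.1 (u, x)).1 hu x
      (Finset.mem_univ x)).symm
  · exact mul_div_cancel₀ _ hu

theorem condXU_le_one (hp : p ∈ stdSimplex ℝ (𝒰 × 𝒳)) (u : 𝒰) (x : 𝒳) : condXU p u x ≤ 1 := by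
  by_cases hu : margU p u = 0
  · simp [condXU, hu]
  · exact (mem_Icc_of_mem_stdSimplex (condXU_mem hp hu) x).2

open Classical in
theorem one_sub_le_sum_typicalU (hp : p ∈ stdSimplex ℝ (𝒰 × 𝒳)) (hn : 0 < n) {ε : ℝ}
    (hε : 0 < ε) :
    1 - Fintype.card 𝒰 / (n * ε ^ 2) ≤
      ∑ v : Fin n → 𝒰, if v ∈ typicalU p ε n then ∏ i, margU p (v i) else 0 := by
  have hn' : (0 : ℝ) < n := by exact_mod_cast hn
  refine one_sub_le_sum_of_deviation hn hε (fun _ => margU p) (fun _ => margU_mem hp)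
    (fun a _ b => if b = a then 1 else 0) (fun a i b => by by_cases h : b = a <;> simp [h]) _
    fun y hy a => ?_
  have := hy a
  simp only [mul_ite, mul_one, mul_zero, Finset.sum_ite_eq', Finset.mem_univ, if_true,
    Finset.sum_sub_distrib, Finset.sum_const, Finset.card_univ, Fintype.card_fin,
    nsmul_eq_mul] at this
  have e : freq y a - margU p a = ((∑ i, if y i = a then 1 else 0) - n * margU p a) / n := by
    unfold freq
    field_simp
  rw [e, abs_div, abs_of_pos hn', div_lt_iff₀ hn']
  linarith

open Classical in
theorem one_sub_le_sum_typicalX (hp : p ∈ stdSimplex ℝ (𝒰 × 𝒳)) (hn : 0 < n) {ε : ℝ}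
    (hε : 0 < ε) {u : Fin n → 𝒰} (hu : u ∈ typicalU p ε n) (hu0 : ∀ i, margU p (u i) ≠ 0) :
    1 - Fintype.card (𝒰 × 𝒳) / (n * ε ^ 2) ≤
      ∑ y : Fin n → 𝒳, if y ∈ typicalX p ε u then ∏ i, condXU p (u i) (y i) else 0 := by
  have hn' : (0 : ℝ) < n := by exact_mod_cast hn
  refine one_sub_le_sum_of_deviation hn hε (fun i => condXU p (u i))
    (fun i => condXU_mem hp (hu0 i))
    (fun (s : 𝒰 × 𝒳) i b => if (u i, b) = s then 1 else 0)
    (fun s i b => by by_cases h : (u i, b) = s <;> simp [h]) _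
    fun y hy a b => ?_
  have h1 := hy (a, b)
  have h2 : ∀ i, ∑ x, condXU p (u i) x * (if (u i, x) = (a, b) then 1 else 0)
      = (if u i = a then 1 else 0) * condXU p a b := by
    intro i
    by_cases h : u i = a <;> simp [h]
  simp only [h2, Finset.sum_sub_distrib, ← Finset.sum_mul] at h1
  -- This is where the `2 * ε` of `typicalX` is used: one `ε` for the fluctuation of `y` given `u`,
  -- one for the deviation of the frequencies of `u` itself.
  have e : freq (fun i => (u i, y i)) (a, b) - p (a, b) =
      ((∑ i, if (u i, y i) = (a, b) then 1 else 0) -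
        (∑ i, if u i = a then 1 else 0) * condXU p a b) / n +
      (freq u a - margU p a) * condXU p a b := by
    rw [sub_mul, margU_mul_condXU hp]
    unfold freq
    field_simp
    ring_nf
  rw [e, two_mul]
  refine (abs_add_le _ _).trans_lt (add_lt_add_of_lt_of_le ?_ ?_)
  · rw [abs_div, abs_of_pos hn', div_lt_iff₀ hn']
    linarith
  · rw [abs_mul, abs_of_nonneg (condXU_nonneg hp a b)]
    exact (mul_le_of_le_one_right (abs_nonneg _) (condXU_le_one hp a b)).trans (hu a).le

end Typical

/-! ### Moments of random bin masses and the Tsallis divergence -/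

section Moments

/-- If `x` is small compared with `y`, the sum is at most a factor `1 + η` above `y`, where `(1 + η)
^ s = 1 + δ`; otherwise `y` is at most a multiple of `x`. The leading constant can thus be brought
arbitrarily close to one, which a plain convexity bound would not allow. -/
theorem exists_add_rpow_le {s δ : ℝ} (hs : 0 < s) (hδ : 0 < δ) :
    ∃ C : ℝ, 0 ≤ C ∧ ∀ x y : ℝ, 0 ≤ x → 0 ≤ y → (x + y) ^ s ≤ (1 + δ) * y ^ s + C * x ^ s := by
  set η : ℝ := (1 + δ) ^ s⁻¹ - 1 with hη
  have hη0 : 0 < η := by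
    have := Real.one_lt_rpow (by linarith : (1 : ℝ) < 1 + δ) (inv_pos.2 hs)
    linarith
  have hη1 : (1 + η) ^ s = 1 + δ := by
    rw [hη, add_sub_cancel, Real.rpow_inv_rpow (by linarith) hs.ne']
  refine ⟨(1 + η⁻¹) ^ s, by positivity, fun x y hx hy => ?_⟩
  rcases le_total x (η * y) with h | h
  · calc (x + y) ^ s ≤ ((1 + η) * y) ^ s :=
          Real.rpow_le_rpow (by positivity) (by linarith) hs.le
      _ = (1 + δ) * y ^ s := by rw [Real.mul_rpow (by positivity) hy, hη1]
      _ ≤ _ := le_add_of_nonneg_right (by positivity)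
  · have hy' : y ≤ η⁻¹ * x := by
      rwa [← div_eq_inv_mul, le_div_iff₀ hη0, mul_comm]
    calc (x + y) ^ s ≤ ((1 + η⁻¹) * x) ^ s :=
          Real.rpow_le_rpow (by positivity) (by linarith) hs.le
      _ = (1 + η⁻¹) ^ s * x ^ s := by rw [Real.mul_rpow (by positivity) hx]
      _ ≤ _ := le_add_of_nonneg_left (by positivity)

theorem mul_rpow_sub_one {x α : ℝ} (hx : 0 ≤ x) (hα : 0 < α) : x * x ^ (α - 1) = x ^ α := by
  rcases hx.eq_or_lt with rfl | hx
  · rw [zero_mul, Real.zero_rpow hα.ne']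
  · rw [Real.rpow_sub_one hx.ne', mul_div_cancel₀ _ hx.ne']

/-- Young's inequality with exponents `α` and `α / (α - 1)`, with denominators cleared. -/
theorem mul_rpow_sub_one_le {m x α : ℝ} (hm : 0 ≤ m) (hx : 0 ≤ x) (hα : 1 < α) :
    α * (m * x ^ (α - 1)) ≤ m ^ α + (α - 1) * x ^ α := by
  have h0 : (0 : ℝ) < α := by linarith
  have hi : α⁻¹ ≤ 1 := inv_le_one_of_one_le₀ hα.le
  have := Real.geom_mean_le_arith_mean2_weighted (inv_nonneg.2 h0.le) (sub_nonneg.2 hi)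
    (Real.rpow_nonneg hm α) (Real.rpow_nonneg hx α) (by ring)
  rw [Real.rpow_rpow_inv hm h0.ne', ← Real.rpow_mul hx] at this
  have e : α * (1 - α⁻¹) = α - 1 := by field_simp
  rw [e] at this
  calc α * (m * x ^ (α - 1)) ≤ α * (α⁻¹ * m ^ α + (1 - α⁻¹) * x ^ α) :=
        mul_le_mul_of_nonneg_left this h0.le
    _ = (α * α⁻¹) * m ^ α + (α * (1 - α⁻¹)) * x ^ α := by ring
    _ = _ := by rw [mul_inv_cancel₀ h0.ne', e, one_mul]

variable {ι : Type*} [Fintype ι] [DecidableEq ι] {M : ℕ}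

/-- A function that ignores the bin of `u` is independent of the bin of `u`. -/
theorem sum_ite_bin (u : ι) (b : Fin M) (hM : 0 < M) (g : ({j // j ≠ u} → Fin M) → ℝ) :
    ∑ B : ι → Fin M, (if B u = b then g (fun j => B j) else 0) =
      (1 / M : ℝ) * ∑ B : ι → Fin M, g (fun j => B j) := by
  have hM' : (M : ℝ) ≠ 0 := by positivity
  have h1 : ∑ B : ι → Fin M, (if B u = b then g (fun j => B j) else 0) =
      ∑ c : Fin M × ({j // j ≠ u} → Fin M), if c.1 = b then g c.2 else 0 :=
    Fintype.sum_equiv (Equiv.funSplitAt u (Fin M)) _ _ fun B => rfl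
  have h2 : ∑ B : ι → Fin M, g (fun j => B j) =
      ∑ c : Fin M × ({j // j ≠ u} → Fin M), g c.2 :=
    Fintype.sum_equiv (Equiv.funSplitAt u (Fin M)) _ _ fun B => rfl
  rw [h1, h2, Fintype.sum_prod_type_right, Fintype.sum_prod_type]
  simp only [Finset.sum_ite_eq', Finset.mem_univ, if_true, Finset.sum_const, Finset.card_univ,
    Fintype.card_fin, nsmul_eq_mul]
  field_simp

/-- The moment bound for the mass of a random bin. -/
theorem sum_bin_rpow_le {α δ C : ℝ} (hα : 1 < α) (hδ : 0 < δ)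
    (hC : ∀ x y : ℝ, 0 ≤ x → 0 ≤ y →
      (x + y) ^ (α - 1) ≤ (1 + δ) * y ^ (α - 1) + C * x ^ (α - 1))
    (hM : 0 < M) (a : ι → ℝ) (ha : ∀ u, 0 ≤ a u) (b : Fin M) :
    (1 - δ * (α - 1)) * ∑ B : ι → Fin M, (∑ u, a u * if B u = b then 1 else 0) ^ α ≤
      ∑ _B : ι → Fin M, ((1 + δ) * ((∑ u, a u) / M) ^ α + α * C * ((∑ u, a u ^ α) / M)) := by
  have h0 : (0 : ℝ) < α := by linarith
  have hM' : (0 : ℝ) < M := by exact_mod_cast hM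
  set S : (ι → Fin M) → ℝ := fun B => ∑ u, a u * if B u = b then 1 else 0 with hS
  set T : (u : ι) → ({j // j ≠ u} → Fin M) → ℝ := fun u B => ∑ j : {j // j ≠ u},
    a j * if B j = b then 1 else 0 with hT
  have hS0 : ∀ B, 0 ≤ S B := fun B => Finset.sum_nonneg fun u _ =>
    mul_nonneg (ha u) (by split_ifs <;> simp)
  have hT0 : ∀ u B, 0 ≤ T u B := fun u B => Finset.sum_nonneg fun j _ =>
    mul_nonneg (ha j) (by split_ifs <;> simp)
  have hST : ∀ u B, S B = a u * (if B u = b then 1 else 0) + T u (fun j => B j) := by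
    intro u B
    simp only [hS, hT]
    rw [← Fintype.sum_subtype_add_sum_subtype (fun j => j = u)
      (fun v => a v * if B v = b then 1 else 0)]
    simp only [Fintype.sum_unique]
    rfl
  have hTS : ∀ u B, T u (fun j => B j) ≤ S B := fun u B => by
    rw [hST u B]
    exact le_add_of_nonneg_left (mul_nonneg (ha u) (by split_ifs <;> simp))
  set m : ℝ := (∑ u, a u) / M with hm
  set V : ℝ := (∑ u, a u ^ α) / M with hV
  have hm0 : 0 ≤ m := div_nonneg (Finset.sum_nonneg fun u _ => ha u) hM'.le
  have hpt : ∀ B, S B ^ α ≤ ∑ u, a u * (if B u = b then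
      (1 + δ) * T u (fun j => B j) ^ (α - 1) + C * a u ^ (α - 1) else 0) := by
    intro B
    rw [← mul_rpow_sub_one (hS0 B) h0]
    conv_lhs => rw [hS]
    simp only
    rw [Finset.sum_mul]
    refine Finset.sum_le_sum fun u _ => ?_
    rw [mul_assoc]
    refine mul_le_mul_of_nonneg_left ?_ (ha u)
    by_cases hB : B u = b
    · rw [if_pos hB, if_pos hB, one_mul]
      have := hST u B
      rw [if_pos hB, mul_one] at this
      change S B ^ (α - 1) ≤ _
      rw [this]
      exact hC _ _ (ha u) (hT0 u _)
    · simp [hB]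
  have hmain : ∑ B, S B ^ α ≤ ∑ B : ι → Fin M, ((1 + δ) * (m * S B ^ (α - 1)) + C * V) := by
    calc ∑ B, S B ^ α ≤ ∑ B : ι → Fin M, ∑ u, a u * (if B u = b then
          (1 + δ) * T u (fun j => B j) ^ (α - 1) + C * a u ^ (α - 1) else 0) :=
          Finset.sum_le_sum fun B _ => hpt B
      _ = ∑ u, a u * ((1 / M : ℝ) * ∑ B : ι → Fin M,
            ((1 + δ) * T u (fun j => B j) ^ (α - 1) + C * a u ^ (α - 1))) := by
          rw [Finset.sum_comm]
          refine Finset.sum_congr rfl fun u _ => ?_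
          rw [← Finset.mul_sum,
            ← sum_ite_bin u b hM (fun B' => (1 + δ) * T u B' ^ (α - 1) + C * a u ^ (α - 1))]
      -- Once independence has produced the factor `1 / M`, the rest `T` may be enlarged to `S`
      -- again, so that the sum over `u` collapses to the mean `m`.
      _ ≤ ∑ u, a u * ((1 / M : ℝ) * ∑ B : ι → Fin M,
            ((1 + δ) * S B ^ (α - 1) + C * a u ^ (α - 1))) := by
          refine Finset.sum_le_sum fun u _ => mul_le_mul_of_nonneg_left
            (mul_le_mul_of_nonneg_left (Finset.sum_le_sum fun B _ => ?_) (by positivity)) (ha u)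
          have := Real.rpow_le_rpow (hT0 u _) (hTS u B) (by linarith : 0 ≤ α - 1)
          gcongr
      _ = _ := by
          simp only [Finset.mul_sum]
          rw [Finset.sum_comm]
          refine Finset.sum_congr rfl fun B _ => ?_
          have hV' : C * V = ∑ u, C * (a u * a u ^ (α - 1)) / M := by
            rw [hV, ← mul_div_assoc, Finset.mul_sum, Finset.sum_div]
            exact Finset.sum_congr rfl fun u _ => by rw [mul_rpow_sub_one (ha u) h0]
          rw [hV', hm, div_mul_eq_mul_div, Finset.sum_mul, Finset.sum_div, Finset.mul_sum,
            ← Finset.sum_add_distrib]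
          exact Finset.sum_congr rfl fun u _ => by ring
  have hY : α * ∑ B : ι → Fin M, ((1 + δ) * (m * S B ^ (α - 1)) + C * V) ≤
      ∑ B : ι → Fin M, ((1 + δ) * (m ^ α + (α - 1) * S B ^ α) + α * C * V) := by
    rw [Finset.mul_sum]
    refine Finset.sum_le_sum fun B _ => ?_
    have := mul_le_mul_of_nonneg_left (mul_rpow_sub_one_le hm0 (hS0 B) hα)
      (by linarith : 0 ≤ 1 + δ)
    linarith
  -- Moving the `S ^ α` term to the left leaves the coefficient `α - (1 + δ) (α - 1) = 1 - δ (α -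
  -- 1)`.
  have e : ∑ B : ι → Fin M, ((1 + δ) * (m ^ α + (α - 1) * S B ^ α) + α * C * V) =
      (1 + δ) * (α - 1) * ∑ B, S B ^ α +
        ∑ _B : ι → Fin M, ((1 + δ) * m ^ α + α * C * V) := by
    rw [Finset.mul_sum, ← Finset.sum_add_distrib]
    exact Finset.sum_congr rfl fun B _ => by ring
  have := (mul_le_mul_of_nonneg_left hmain h0.le).trans hY
  rw [e] at this
  linarith

/-- The expected power sum of the binned law with respect to the ideal law. -/
theorem sum_binned_rpow_le {Z : Type*} [Fintype Z] {α δ C : ℝ} (hα : 1 < α) (hδ : 0 < δ)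
    (hC : ∀ x y : ℝ, 0 ≤ x → 0 ≤ y →
      (x + y) ^ (α - 1) ≤ (1 + δ) * y ^ (α - 1) + C * x ^ (α - 1))
    (hM : 0 < M) (a : ι → Z → ℝ) (ha : ∀ u z, 0 ≤ a u z) (q : Z → ℝ) (hq : ∀ z, 0 ≤ q z) :
    (1 - δ * (α - 1)) * ∑ B : ι → Fin M, (∏ _u : ι, (1 / M : ℝ)) *
        ∑ c : Fin M × Z, (∑ u, a u c.2 * if B u = c.1 then 1 else 0) ^ α *
          (1 / M * q c.2) ^ (1 - α) ≤
      (1 + δ) * ∑ z, (∑ u, a u z) ^ α * q z ^ (1 - α) +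
        α * C * ((M : ℝ) ^ (α - 1) * ∑ u, ∑ z, a u z ^ α * q z ^ (1 - α)) := by
  have hM' : (0 : ℝ) < M := by exact_mod_cast hM
  have hw : ∑ _B : ι → Fin M, (∏ _u : ι, (1 / M : ℝ)) = 1 := by
    simp only [Finset.prod_const, Finset.sum_const, Finset.card_univ, Fintype.card_fun,
      Fintype.card_fin, nsmul_eq_mul, Nat.cast_pow]
    rw [← mul_pow, mul_one_div_cancel hM'.ne', one_pow]
  set w : ℝ := ∏ _u : ι, (1 / M : ℝ) with hw'
  have hw0 : 0 ≤ w := Finset.prod_nonneg fun _ _ => by positivity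
  have hMq : ∀ z, (1 / M * q z) ^ (1 - α) = (M : ℝ) ^ (α - 1) * q z ^ (1 - α) := by
    intro z
    rw [Real.mul_rpow (by positivity) (hq z), one_div, Real.inv_rpow hM'.le,
      ← Real.rpow_neg hM'.le, neg_sub]
  have hwK : ∀ K : ℝ, w * ∑ _B : ι → Fin M, K = K := fun K => by
    rw [Finset.mul_sum, ← Finset.sum_mul, hw, one_mul]
  have key : ∀ c : Fin M × Z, (1 - δ * (α - 1)) *
      (w * ∑ B : ι → Fin M, (∑ u, a u c.2 * if B u = c.1 then 1 else 0) ^ α) ≤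
      (1 + δ) * ((∑ u, a u c.2) / M) ^ α + α * C * ((∑ u, a u c.2 ^ α) / M) := by
    intro c
    have := mul_le_mul_of_nonneg_left
      (sum_bin_rpow_le hα hδ hC hM (fun u => a u c.2) (fun u => ha u c.2) c.1) hw0
    rw [hwK] at this
    linarith
  calc _ = ∑ c : Fin M × Z, ((1 - δ * (α - 1)) *
      (w * ∑ B : ι → Fin M, (∑ u, a u c.2 * if B u = c.1 then 1 else 0) ^ α)) *
        ((M : ℝ) ^ (α - 1) * q c.2 ^ (1 - α)) := by
        simp only [Finset.mul_sum, Finset.sum_mul, hMq]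
        rw [Finset.sum_comm]
        exact Finset.sum_congr rfl fun c _ => Finset.sum_congr rfl fun B _ => by ring
    _ ≤ ∑ c : Fin M × Z, ((1 + δ) * ((∑ u, a u c.2) / M) ^ α +
          α * C * ((∑ u, a u c.2 ^ α) / M)) * ((M : ℝ) ^ (α - 1) * q c.2 ^ (1 - α)) :=
        Finset.sum_le_sum fun c _ => mul_le_mul_of_nonneg_right (key c)
          (mul_nonneg (by positivity) (Real.rpow_nonneg (hq _) _))
    _ = _ := by
        rw [Fintype.sum_prod_type]
        simp only [Finset.sum_const, Finset.card_univ, Fintype.card_fin, nsmul_eq_mul]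
        rw [Finset.sum_comm (f := fun u z => a u z ^ α * q z ^ (1 - α))]
        simp only [Finset.mul_sum, ← Finset.sum_add_distrib]
        refine Finset.sum_congr rfl fun z _ => ?_
        rw [Real.div_rpow (Finset.sum_nonneg fun u _ => ha u z) hM'.le,
          ← mul_rpow_sub_one hM'.le (by linarith : 0 < α)]
        have : (M : ℝ) ^ (α - 1) ≠ 0 := (Real.rpow_pos_of_pos hM' _).ne'
        have e2 : ∑ u, α * (C * ((M : ℝ) ^ (α - 1) * (a u z ^ α * q z ^ (1 - α)))) =
          (∑ u, a u z ^ α) * (α * C * (M : ℝ) ^ (α - 1) * q z ^ (1 - α)) := by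
          rw [Finset.sum_mul]
          exact Finset.sum_congr rfl fun u _ => by ring
        simp only [mul_assoc] at e2 ⊢
        rw [e2]
        field_simp

/-- Bernoulli's inequality is the tangent bound for `x ^ α` at `x = 1`. Applied to `P a / Q a` and
averaged over `Q`, its linear term vanishes. -/
theorem tsallisDiv_nonneg {A : Type*} [Fintype A] {α : ℝ} (hα : 1 < α) {P Q : A → ℝ}
    (hP : P ∈ stdSimplex ℝ A) (hQ : Q ∈ stdSimplex ℝ A) (hPQ : ∀ a, Q a = 0 → P a = 0) :
    0 ≤ tsallisDiv α P Q := by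
  refine mul_nonneg (one_div_nonneg.2 (by linarith)) (sub_nonneg.2 ?_)
  have hpt : ∀ a, Q a + α * (P a - Q a) ≤ P a ^ α * Q a ^ (1 - α) := by
    intro a
    rcases (hQ.1 a).eq_or_lt with h | h
    · rw [hPQ a h.symm, ← h, Real.zero_rpow (by linarith : α ≠ 0)]
      simp
    · have h1 := one_add_mul_self_le_rpow_one_add (s := P a / Q a - 1)
        (by linarith [div_nonneg (hP.1 a) h.le]) hα.le
      rw [add_sub_cancel] at h1
      have h2 := mul_le_mul_of_nonneg_left h1 h.le
      have e1 : Q a * (1 + α * (P a / Q a - 1)) = Q a + α * (P a - Q a) := by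
        field_simp
      have e2 : Q a * (P a / Q a) ^ α = P a ^ α * Q a ^ (1 - α) := by
        rw [Real.div_rpow (hP.1 a) h.le, Real.rpow_sub h, Real.rpow_one]
        ring
      rwa [e1, e2] at h2
  calc (1 : ℝ) = ∑ a, (Q a + α * (P a - Q a)) := by
        rw [Finset.sum_add_distrib, ← Finset.mul_sum, Finset.sum_sub_distrib, hP.2, hQ.2]
        ring
    _ ≤ _ := Finset.sum_le_sum fun a _ => hpt a

end Moments

/-! ### Empirical frequencies and the number of types -/

section Frequencies

variable {A B : Type*} {n : ℕ}

theorem sum_comp_eq_freq [Fintype A] (w : Fin n → A) (L : A → ℝ) :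
    ∑ i, L (w i) = n * ∑ a, freq w a * L a := by
  classical
  rcases Nat.eq_zero_or_pos n with rfl | hn
  · simp
  have hn' : (n : ℝ) ≠ 0 := by positivity
  have h : ∀ a, freq w a * L a = (∑ i, if w i = a then L a else 0) / n := by
    intro a
    unfold freq
    rw [div_mul_eq_mul_div, Finset.sum_mul]
    simp only [ite_mul, one_mul, zero_mul]
  simp only [h, ← Finset.sum_div]
  rw [mul_div_cancel₀ _ hn', Finset.sum_comm]
  simp

theorem freq_nonneg (w : Fin n → A) (a : A) : 0 ≤ freq w a :=
  div_nonneg (Finset.sum_nonneg fun i _ => by split_ifs <;> simp) n.cast_nonneg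

theorem exists_of_freq_ne_zero {w : Fin n → A} {a : A} (h : freq w a ≠ 0) : ∃ i, w i = a := by
  by_contra! hc
  exact h (by simp [freq, hc])

theorem freq_apply_pos (w : Fin n → A) (i : Fin n) : 0 < freq w (w i) := by
  have hn : (0 : ℝ) < n := by exact_mod_cast i.pos
  refine div_pos (lt_of_lt_of_le one_pos ?_) hn
  refine le_trans ?_ (Finset.single_le_sum (fun j _ => ?_) (Finset.mem_univ i))
  · simp
  · split_ifs <;> simp

theorem freq_fst [Fintype B] (v : Fin n → A) (z : Fin n → B) (a : A) :
    freq v a = ∑ b, freq (fun i => (v i, z i)) (a, b) := by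
  classical
  simp only [freq, ← Finset.sum_div]
  rw [Finset.sum_comm]
  congr 1
  refine Finset.sum_congr rfl fun i _ => ?_
  by_cases h : v i = a <;> simp [h]

/-- A product over a sequence depends only on its type. Positivity is needed just at the letters
that occur, since all others have frequency zero. -/
theorem prod_eq_rpow_freq [Fintype A] (w : Fin n → A) (φ : A → ℝ) (hφ : ∀ i, 0 < φ (w i)) :
    ∏ i, φ (w i) = 2 ^ (n * ∑ a, freq w a * Real.logb 2 (φ a)) := by
  rw [← sum_comp_eq_freq w (fun a => Real.logb 2 (φ a)), Real.rpow_sum_of_pos two_pos]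
  exact Finset.prod_congr rfl fun i _ =>
    (Real.rpow_logb two_pos (by norm_num) (hφ i)).symm

open Classical in
/-- The number of types of sequences of length `n` is polynomial in `n`. -/
theorem card_image_freq_le (A : Type*) [Fintype A] (n : ℕ) :
    (Finset.univ.image (freq : (Fin n → A) → A → ℝ)).card ≤ (n + 1) ^ Fintype.card A := by
  set c : (A → Fin (n + 1)) → A → ℝ := fun k a => ((k a : ℕ) : ℝ) / n
  have hsub : Finset.univ.image (freq : (Fin n → A) → A → ℝ) ⊆ Finset.univ.image c := by
    intro f hf
    obtain ⟨w, -, rfl⟩ := Finset.mem_image.1 hf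
    refine Finset.mem_image.2 ⟨fun a => ⟨(Finset.univ.filter fun i => w i = a).card, ?_⟩,
      Finset.mem_univ _, ?_⟩
    · exact Nat.lt_succ_of_le ((Finset.card_le_univ _).trans (by simp))
    · funext a
      simp [c, freq]
  calc _ ≤ (Finset.univ.image c).card := Finset.card_le_card hsub
    _ ≤ (Finset.univ : Finset (A → Fin (n + 1))).card := Finset.card_image_le
    _ = _ := by simp

end Frequencies

/-! ### The single-letter exponent and its continuity -/

section Exponent

variable {𝒰 𝒳 𝒵 : Type*} [Fintype 𝒰] [Fintype 𝒳] [Fintype 𝒵] {p : 𝒰 × 𝒳 → ℝ}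
  {W : 𝒳 → 𝒵 → ℝ} {t : 𝒰 × 𝒳 → 𝒵 → ℝ}

theorem margX_nonneg (hp : p ∈ stdSimplex ℝ (𝒰 × 𝒳)) (x : 𝒳) : 0 ≤ margX p x :=
  Finset.sum_nonneg fun _ _ => hp.1 _

theorem outZ_nonneg (hp : p ∈ stdSimplex ℝ (𝒰 × 𝒳)) (hW : ∀ x, W x ∈ stdSimplex ℝ 𝒵) (z : 𝒵) :
    0 ≤ outZ p W z :=
  Finset.sum_nonneg fun x _ => mul_nonneg (margX_nonneg hp x) ((hW x).1 z)

theorem outZ_mem (hp : p ∈ stdSimplex ℝ (𝒰 × 𝒳)) (hW : ∀ x, W x ∈ stdSimplex ℝ 𝒵) :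
    outZ p W ∈ stdSimplex ℝ 𝒵 := by
  refine ⟨outZ_nonneg hp hW, ?_⟩
  simp only [outZ]
  rw [Finset.sum_comm]
  simp only [← Finset.mul_sum, (hW _).2, mul_one, margX]
  rw [Finset.sum_comm, ← hp.2, Fintype.sum_prod_type]

theorem outZ_pos (hp : p ∈ stdSimplex ℝ (𝒰 × 𝒳)) (hW : ∀ x, W x ∈ stdSimplex ℝ 𝒵)
    {s : 𝒰 × 𝒳} {z : 𝒵} (hs : p s ≠ 0) (hz : W s.2 z ≠ 0) : 0 < outZ p W z := by
  refine Finset.sum_pos' (fun x _ => mul_nonneg (margX_nonneg hp x) ((hW x).1 z))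
    ⟨s.2, Finset.mem_univ _, mul_pos ?_ (lt_of_le_of_ne ((hW _).1 z) hz.symm)⟩
  exact Finset.sum_pos' (fun u _ => hp.1 _) ⟨s.1, Finset.mem_univ _,
    lt_of_le_of_ne (hp.1 s) hs.symm⟩

theorem margU_pos (hp : p ∈ stdSimplex ℝ (𝒰 × 𝒳)) {s : 𝒰 × 𝒳} (hs : p s ≠ 0) :
    0 < margU p s.1 :=
  Finset.sum_pos' (fun _ _ => hp.1 _) ⟨s.2, Finset.mem_univ _, lt_of_le_of_ne (hp.1 s) hs.symm⟩

theorem condXU_pos (hp : p ∈ stdSimplex ℝ (𝒰 × 𝒳)) {s : 𝒰 × 𝒳} (hs : p s ≠ 0) :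
    0 < condXU p s.1 s.2 :=
  div_pos (lt_of_le_of_ne (hp.1 s) hs.symm) (margU_pos hp hs)

theorem condZU_mem (hp : p ∈ stdSimplex ℝ (𝒰 × 𝒳)) (ht : ∀ s, t s ∈ stdSimplex ℝ 𝒵) {u : 𝒰}
    (hu : margU p u ≠ 0) : condZU p t u ∈ stdSimplex ℝ 𝒵 := by
  refine ⟨fun z => Finset.sum_nonneg fun x _ => mul_nonneg (condXU_nonneg hp u x) ((ht _).1 z), ?_⟩
  simp only [condZU]
  rw [Finset.sum_comm]
  simp only [← Finset.mul_sum, (ht _).2, mul_one]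
  exact (condXU_mem hp hu).2

theorem condXU_mul_le_condZU (hp : p ∈ stdSimplex ℝ (𝒰 × 𝒳)) (ht : ∀ s, t s ∈ stdSimplex ℝ 𝒵)
    (s : 𝒰 × 𝒳) (z : 𝒵) : condXU p s.1 s.2 * t s z ≤ condZU p t s.1 z :=
  Finset.single_le_sum (f := fun x => condXU p s.1 x * t (s.1, x) z)
    (fun x _ => mul_nonneg (condXU_nonneg hp _ x) ((ht _).1 z)) (Finset.mem_univ s.2)

/-- The objective of the maximum that defines `auxRate`. -/
noncomputable def rateObjective (α : ℝ) (p : 𝒰 × 𝒳 → ℝ) (W : 𝒳 → 𝒵 → ℝ) (t : 𝒰 × 𝒳 → 𝒵 → ℝ) : ℝ :=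
  -(α / (α - 1)) * condKlDiv t (fun s => W s.2) p
    + condKlDiv (condZU p t) (fun _ => outZ p W) (margU p)

/-- The exponent that a joint type with conditional law `t` contributes at a letter. -/
noncomputable def letterExponent (α : ℝ) (p : 𝒰 × 𝒳 → ℝ) (W : 𝒳 → 𝒵 → ℝ) (t : 𝒰 × 𝒳 → 𝒵 → ℝ)
    (s : 𝒰 × 𝒳) (z : 𝒵) : ℝ :=
  -α * Real.logb 2 (t s z / W s.2 z) + (α - 1) * Real.logb 2 (condZU p t s.1 z / outZ p W z)

/-- The second logarithm does not depend on `x`, so averaging over `x` turns its weight into `p(u)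
t(z|u)`; the factor `α - 1` clears the denominator in the objective. -/
theorem sum_letterExponent (hp : p ∈ stdSimplex ℝ (𝒰 × 𝒳)) {α : ℝ} (hα : 1 < α) :
    ∑ s, p s * ∑ z, t s z * letterExponent α p W t s z = (α - 1) * rateObjective α p W t := by
  have h1 : (α - 1) ≠ 0 := by linarith
  have h2 : condKlDiv (condZU p t) (fun _ => outZ p W) (margU p) =
      ∑ s, p s * ∑ z, t s z * Real.logb 2 (condZU p t s.1 z / outZ p W z) := by
    rw [Fintype.sum_prod_type]
    refine Finset.sum_congr rfl fun u _ => ?_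
    simp only [klDiv, Finset.mul_sum]
    rw [Finset.sum_comm]
    refine Finset.sum_congr rfl fun z _ => ?_
    rw [← mul_assoc]
    nth_rewrite 1 [condZU]
    rw [Finset.mul_sum, Finset.sum_mul]
    refine Finset.sum_congr rfl fun x _ => ?_
    rw [← mul_assoc, margU_mul_condXU hp]
    ring
  have h3 : (α - 1) * rateObjective α p W t = -α * condKlDiv t (fun s => W s.2) p +
      (α - 1) * condKlDiv (condZU p t) (fun _ => outZ p W) (margU p) := by
    rw [rateObjective]
    field_simp
  rw [h3, h2]
  simp only [condKlDiv, klDiv, letterExponent, Finset.mul_sum, ← Finset.sum_add_distrib]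
  exact Finset.sum_congr rfl fun s _ => Finset.sum_congr rfl fun z _ => by ring

theorem mul_abs_logb_le_two {x : ℝ} (h0 : 0 < x) (h1 : x ≤ 1) : x * |Real.logb 2 x| ≤ 2 := by
  have h := (Real.abs_log_mul_self_lt x h0 h1).le
  rw [abs_mul, abs_of_pos h0] at h
  have h2 := Real.log_two_gt_d9
  rw [Real.logb, abs_div, abs_of_pos (by linarith : 0 < Real.log 2), ← mul_div_assoc,
    div_le_iff₀ (by linarith)]
  linarith

/-- The point is uniformity in `t`. The logarithm of `t` is tamed by its weight `t`, since `t |log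
t|` is bounded. That of `t(z|u)` is controlled through `p(x|u) t(z|u,x) ≤ t(z|u) ≤ 1`. The remaining
logarithms are fixed numbers. The bound also makes the supremum in `auxRate` one over a set bounded
above. -/
theorem exists_abs_letterExponent_le (hp : p ∈ stdSimplex ℝ (𝒰 × 𝒳))
    (hW : ∀ x, W x ∈ stdSimplex ℝ 𝒵) {α : ℝ} (hα : 1 < α) :
    ∃ K : 𝒰 × 𝒳 → ℝ, (∀ s, 0 ≤ K s) ∧ ∀ t ∈ auxChannels p W, ∀ s, p s ≠ 0 →
      |∑ z, t s z * letterExponent α p W t s z| ≤ K s := by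
  have hα1 : 0 < α - 1 := by linarith
  refine ⟨fun s => ∑ z, (α * (2 + |Real.logb 2 (W s.2 z)|) +
    (α - 1) * ((|Real.logb 2 (condXU p s.1 s.2)| + 2) + |Real.logb 2 (outZ p W z)|)),
    fun s => Finset.sum_nonneg fun z _ => by positivity, fun t ht s hs => ?_⟩
  refine (Finset.abs_sum_le_sum_abs _ _).trans (Finset.sum_le_sum fun z _ => ?_)
  rcases ((ht.1 s).1 z).eq_or_lt with h0 | h0
  · rw [← h0, zero_mul, abs_zero]
    positivity
  have h1 : t s z ≤ 1 := (mem_Icc_of_mem_stdSimplex (ht.1 s) z).2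
  have hWz : W s.2 z ≠ 0 := fun h => h0.ne' (ht.2 s.1 s.2 z hs h)
  have hc := condXU_pos hp hs
  have hS := condXU_mul_le_condZU hp ht.1 s z
  have hS0 : 0 < condZU p t s.1 z := lt_of_lt_of_le (mul_pos hc h0) hS
  have hS1 : condZU p t s.1 z ≤ 1 :=
    (mem_Icc_of_mem_stdSimplex (condZU_mem hp ht.1 (margU_pos hp hs).ne') z).2
  have hlS : |Real.logb 2 (condZU p t s.1 z)| ≤
      |Real.logb 2 (condXU p s.1 s.2)| + |Real.logb 2 (t s z)| := by
    rw [abs_of_nonpos (Real.logb_nonpos one_lt_two hS0.le hS1)]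
    have := Real.logb_le_logb_of_le one_lt_two (mul_pos hc h0) hS
    rw [Real.logb_mul hc.ne' h0.ne'] at this
    linarith [neg_abs_le (Real.logb 2 (condXU p s.1 s.2)), neg_abs_le (Real.logb 2 (t s z))]
  have ht2 := mul_abs_logb_le_two h0 h1
  have hle : ∀ y : ℝ, t s z * |y| ≤ |y| := fun y => mul_le_of_le_one_left (abs_nonneg y) h1
  have hA : t s z * |Real.logb 2 (t s z / W s.2 z)| ≤ 2 + |Real.logb 2 (W s.2 z)| := by
    rw [Real.logb_div h0.ne' hWz]
    have := mul_le_mul_of_nonneg_left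
      (abs_sub (Real.logb 2 (t s z)) (Real.logb 2 (W s.2 z))) h0.le
    linarith [hle (Real.logb 2 (W s.2 z))]
  have hB : t s z * |Real.logb 2 (condZU p t s.1 z / outZ p W z)| ≤
      (|Real.logb 2 (condXU p s.1 s.2)| + 2) + |Real.logb 2 (outZ p W z)| := by
    rw [Real.logb_div hS0.ne' (outZ_pos hp hW hs hWz).ne']
    have h3 := mul_le_mul_of_nonneg_left
      (abs_sub (Real.logb 2 (condZU p t s.1 z)) (Real.logb 2 (outZ p W z))) h0.le
    have h4 := mul_le_mul_of_nonneg_left hlS h0.le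
    linarith [hle (Real.logb 2 (outZ p W z)), hle (Real.logb 2 (condXU p s.1 s.2))]
  rw [abs_mul, abs_of_pos h0, letterExponent]
  have h5 := mul_le_mul_of_nonneg_left (abs_add_le
    (-α * Real.logb 2 (t s z / W s.2 z))
    ((α - 1) * Real.logb 2 (condZU p t s.1 z / outZ p W z))) h0.le
  rw [abs_mul, abs_mul, abs_neg, abs_of_pos (by linarith : 0 < α), abs_of_pos hα1] at h5
  have h6 := mul_le_mul_of_nonneg_left hA (by linarith : 0 ≤ α)
  have h7 := mul_le_mul_of_nonneg_left hB hα1.le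
  linarith

theorem rateObjective_le_auxRate (hp : p ∈ stdSimplex ℝ (𝒰 × 𝒳))
    (hW : ∀ x, W x ∈ stdSimplex ℝ 𝒵) {α : ℝ} (hα : 1 < α) (ht : t ∈ auxChannels p W) :
    rateObjective α p W t ≤ auxRate α p W := by
  have hα1 : 0 < α - 1 := by linarith
  obtain ⟨K, hK0, hK⟩ := exists_abs_letterExponent_le hp hW hα
  refine le_csSup ⟨(∑ s, p s * K s) / (α - 1), ?_⟩ ⟨t, ht, rfl⟩
  rintro _ ⟨t', ht', rfl⟩
  change rateObjective α p W t' ≤ _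
  rw [le_div_iff₀ hα1, mul_comm, ← sum_letterExponent hp hα]
  refine Finset.sum_le_sum fun s _ => ?_
  by_cases hs : p s = 0
  · simp [hs]
  · exact mul_le_mul_of_nonneg_left ((le_abs_self _).trans (hK t' ht' s hs)) (hp.1 s)

/-- Continuity of the exponent in the law of the first two letters, uniformly in the channel. -/
theorem exists_exponent_le (hp : p ∈ stdSimplex ℝ (𝒰 × 𝒳))
    (hW : ∀ x, W x ∈ stdSimplex ℝ 𝒵) {α : ℝ} (hα : 1 < α) :
    ∃ G : ℝ, 0 ≤ G ∧ ∀ t ∈ auxChannels p W, ∀ (ρ : 𝒰 × 𝒳 → ℝ) (ε : ℝ),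
      (∀ s, |ρ s - p s| < 2 * ε) → (∀ s, p s = 0 → ρ s = 0) →
      ∑ s, ρ s * ∑ z, t s z * letterExponent α p W t s z ≤ (α - 1) * auxRate α p W + ε * G := by
  obtain ⟨K, hK0, hK⟩ := exists_abs_letterExponent_le hp hW hα
  refine ⟨2 * ∑ s, K s, mul_nonneg zero_le_two (Finset.sum_nonneg fun s _ => hK0 s),
    fun t ht ρ ε hρ hρ0 => ?_⟩
  have h1 := mul_le_mul_of_nonneg_left (rateObjective_le_auxRate hp hW hα ht)
    (by linarith : 0 ≤ α - 1)
  rw [← sum_letterExponent hp hα] at h1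
  have h2 : ∑ s, ρ s * ∑ z, t s z * letterExponent α p W t s z ≤
      ∑ s, (p s * (∑ z, t s z * letterExponent α p W t s z) + 2 * ε * K s) := by
    refine Finset.sum_le_sum fun s _ => ?_
    by_cases hs : p s = 0
    · rw [hρ0 s hs, hs]
      have : 0 ≤ 2 * ε := (abs_nonneg _).trans (hρ s).le
      simpa using mul_nonneg this (hK0 s)
    · have h3 : (ρ s - p s) * ∑ z, t s z * letterExponent α p W t s z ≤ 2 * ε * K s := by
        refine (le_abs_self _).trans ?_
        rw [abs_mul]
        exact mul_le_mul (hρ s).le (hK t ht s hs) (abs_nonneg _)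
          ((abs_nonneg _).trans (hρ s).le)
      linarith
  rw [Finset.sum_add_distrib, ← Finset.mul_sum] at h2
  linarith

end Exponent

/-! ### Power sums by joint types -/

section Types

variable {𝒰 𝒳 𝒵 : Type*} {p : 𝒰 × 𝒳 → ℝ} {W : 𝒳 → 𝒵 → ℝ} {n : ℕ}

/-- The sequence of triples formed from three sequences. -/
def zip3 (u : Fin n → 𝒰) (x : Fin n → 𝒳) (z : Fin n → 𝒵) (i : Fin n) : (𝒰 × 𝒳) × 𝒵 :=
  ((u i, x i), z i)

open Classical in
/-- The conditional law of the third letter under a joint type, completed by the channel. -/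
noncomputable def typeChannel [Fintype 𝒵] (W : 𝒳 → 𝒵 → ℝ) (τ : (𝒰 × 𝒳) × 𝒵 → ℝ) (s : 𝒰 × 𝒳) (z : 𝒵) : ℝ :=
  if ∑ z', τ (s, z') = 0 then W s.2 z else τ (s, z) / ∑ z', τ (s, z')

theorem sum_mul_typeChannel [Fintype 𝒵] {τ : (𝒰 × 𝒳) × 𝒵 → ℝ} (hτ : ∀ a, 0 ≤ τ a) (s : 𝒰 × 𝒳) (z : 𝒵) :
    (∑ z', τ (s, z')) * typeChannel W τ s z = τ (s, z) := by
  by_cases h : ∑ z', τ (s, z') = 0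
  · rw [h, zero_mul]
    exact ((Finset.sum_eq_zero_iff_of_nonneg fun z _ => hτ (s, z)).1 h z
      (Finset.mem_univ z)).symm
  · rw [typeChannel, if_neg h, mul_div_cancel₀ _ h]

theorem typeChannel_mem [Fintype 𝒵] (hW : ∀ x, W x ∈ stdSimplex ℝ 𝒵) {τ : (𝒰 × 𝒳) × 𝒵 → ℝ}
    (hτ : ∀ a, 0 ≤ τ a) (s : 𝒰 × 𝒳) : typeChannel W τ s ∈ stdSimplex ℝ 𝒵 := by
  by_cases h : ∑ z', τ (s, z') = 0
  · have : typeChannel W τ s = W s.2 := funext fun z => if_pos h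
    rw [this]
    exact hW _
  · have : typeChannel W τ s = fun z => τ (s, z) / ∑ z', τ (s, z') := funext fun z => if_neg h
    rw [this]
    exact ⟨fun z => div_nonneg (hτ _) (Finset.sum_nonneg fun z _ => hτ _), by
      rw [← Finset.sum_div, div_self h]⟩

variable [Fintype 𝒰] [Fintype 𝒳] [Fintype 𝒵]

open Classical in
/-- The part of the output measure of the restricted random input that belongs to a joint type. -/
noncomputable def typeMass (p : 𝒰 × 𝒳 → ℝ) (W : 𝒳 → 𝒵 → ℝ) (ε : ℝ) (u : Fin n → 𝒰)
    (τ : (𝒰 × 𝒳) × 𝒵 → ℝ) (z : Fin n → 𝒵) : ℝ :=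
  ∑ x : Fin n → 𝒳, if x ∈ typicalX p ε u ∧ freq (zip3 u x z) = τ then
    ∏ i, condXU p (u i) (x i) * W (x i) (z i) else 0

theorem typeMass_nonneg (hp : p ∈ stdSimplex ℝ (𝒰 × 𝒳)) (hW : ∀ x, W x ∈ stdSimplex ℝ 𝒵)
    (ε : ℝ) (u : Fin n → 𝒰) (τ : (𝒰 × 𝒳) × 𝒵 → ℝ) (z : Fin n → 𝒵) : 0 ≤ typeMass p W ε u τ z :=
  Finset.sum_nonneg fun x _ => by
    split_ifs
    · exact Finset.prod_nonneg fun i _ => mul_nonneg (condXU_nonneg hp _ _) ((hW _).1 _)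
    · exact le_rfl

/-- The contribution of one joint type to the power sum, bounded by its letter exponents. -/
theorem sum_typeMass_rpow_le (hp : p ∈ stdSimplex ℝ (𝒰 × 𝒳)) (hW : ∀ x, W x ∈ stdSimplex ℝ 𝒵)
    {α : ℝ} (hα : 1 < α) (ε : ℝ) {u : Fin n → 𝒰} (hu : ∀ i, margU p (u i) ≠ 0)
    {τ : (𝒰 × 𝒳) × 𝒵 → ℝ} (hτ : ∀ a, 0 ≤ τ a)
    (hpos : ∀ s z, τ (s, z) ≠ 0 → p s ≠ 0 ∧ W s.2 z ≠ 0) :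
    ∑ z : Fin n → 𝒵, typeMass p W ε u τ z ^ α * (∏ i, outZ p W (z i)) ^ (1 - α) ≤
      2 ^ (n * ∑ a, τ a * letterExponent α p W (typeChannel W τ) a.1 a.2) := by
  classical
  set t := typeChannel W τ with ht
  have htm : ∀ s, t s ∈ stdSimplex ℝ 𝒵 := typeChannel_mem hW hτ
  set S : 𝒰 → 𝒵 → ℝ := condZU p t with hS
  have hS0 : ∀ u z, 0 ≤ S u z := fun u z =>
    Finset.sum_nonneg fun x _ => mul_nonneg (condXU_nonneg hp u x) ((htm _).1 z)
  have hpos' : ∀ s z, τ (s, z) ≠ 0 → 0 < condXU p s.1 s.2 ∧ 0 < W s.2 z ∧ 0 < t s z ∧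
      0 < S s.1 z ∧ 0 < outZ p W z := by
    intro s z h
    obtain ⟨h1, h2⟩ := hpos s z h
    have ht0 : 0 < t s z := by
      refine lt_of_le_of_ne ((htm s).1 z) fun h0 => h ?_
      rw [← sum_mul_typeChannel (W := W) hτ, ← ht, ← h0, mul_zero]
    exact ⟨condXU_pos hp h1, lt_of_le_of_ne ((hW _).1 z) h2.symm, ht0,
      lt_of_lt_of_le (mul_pos (condXU_pos hp h1) ht0) (condXU_mul_le_condZU hp htm s z),
      outZ_pos hp hW h1 h2⟩
  -- Change of measure: `p(x|u) W` is the reverse channel `p(x|u) t / S` times `φ`. On one type the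
  -- product of `φ` is the constant `2 ^ Γ`, while the reverse channel has total mass at most one.
  set φ : (𝒰 × 𝒳) × 𝒵 → ℝ := fun a => W a.1.2 a.2 * S a.1.1 a.2 / t a.1 a.2 with hφ
  set Γ : ℝ := n * ∑ a, τ a * Real.logb 2 (φ a) with hΓ
  set Q : ℝ := n * ∑ a, τ a * Real.logb 2 (outZ p W a.2) with hQ
  set Λ : ℝ := n * ∑ a, τ a * Real.logb 2 (S a.1.1 a.2) with hΛ
  have hocc : ∀ x z, freq (zip3 u x z) = τ → ∀ i, τ ((u i, x i), z i) ≠ 0 := by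
    intro x z h i
    rw [← h]
    exact (freq_apply_pos (zip3 u x z) i).ne'
  have hmass : ∀ z, typeMass p W ε u τ z ≤ 2 ^ Γ := by
    intro z
    calc typeMass p W ε u τ z ≤ ∑ x : Fin n → 𝒳,
          (∏ i, condXU p (u i) (x i) * t (u i, x i) (z i) / S (u i) (z i)) * 2 ^ Γ := by
          refine Finset.sum_le_sum fun x _ => ?_
          have hnn : 0 ≤ (∏ i, condXU p (u i) (x i) * t (u i, x i) (z i) / S (u i) (z i)) * 2 ^ Γ :=
            mul_nonneg (Finset.prod_nonneg fun i _ => div_nonneg (mul_nonneg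
              (condXU_nonneg hp _ _) ((htm _).1 _)) (hS0 _ _)) (by positivity)
          split_ifs with h
          · have hb := fun i => hpos' _ _ (hocc x z h.2 i)
            have e : (2 : ℝ) ^ Γ = ∏ i, φ ((u i, x i), z i) := by
              rw [hΓ, ← h.2]
              refine (prod_eq_rpow_freq (zip3 u x z) φ fun i => ?_).symm
              exact div_pos (mul_pos (hb i).2.1 (hb i).2.2.2.1) (hb i).2.2.1
            rw [e, ← Finset.prod_mul_distrib]
            refine (Finset.prod_congr rfl fun i _ => ?_).le
            have h1 := (hb i).2.2.2.1.ne'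
            have h2 := (hb i).2.2.1.ne'
            simp only [hφ] at h1 h2 ⊢
            field_simp
          · exact hnn
      _ = (∏ i, ∑ x, condXU p (u i) x * t (u i, x) (z i) / S (u i) (z i)) * 2 ^ Γ := by
          rw [← Finset.sum_mul,
            sum_prod_pi (fun i x => condXU p (u i) x * t (u i, x) (z i) / S (u i) (z i))]
      _ ≤ 1 * 2 ^ Γ := by
          refine mul_le_mul_of_nonneg_right (Finset.prod_le_one (fun i _ => ?_) fun i _ => ?_)
            (by positivity)
          · exact Finset.sum_nonneg fun x _ => div_nonneg (mul_nonneg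
              (condXU_nonneg hp _ _) ((htm _).1 _)) (hS0 _ _)
          · rw [← Finset.sum_div]
            -- The numerator sums to `S`; the quotient is one, or zero by convention when `S`
            -- vanishes.
            exact div_self_le_one _
      _ = 2 ^ Γ := one_mul _
  -- The weight `∏ S` equals `2 ^ Λ` at every `z` compatible with the type and sums to one over all
  -- `z`, so it replaces counting the sequences in a type class.
  have hpt : ∀ z : Fin n → 𝒵, typeMass p W ε u τ z ^ α * (∏ i, outZ p W (z i)) ^ (1 - α) ≤
      (∏ i, S (u i) (z i)) * 2 ^ (Γ * α + Q * (1 - α) - Λ) := by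
    intro z
    have hnn : 0 ≤ (∏ i, S (u i) (z i)) * (2 : ℝ) ^ (Γ * α + Q * (1 - α) - Λ) :=
      mul_nonneg (Finset.prod_nonneg fun i _ => hS0 _ _) (by positivity)
    by_cases hx : ∃ x, freq (zip3 u x z) = τ
    · obtain ⟨x, hx⟩ := hx
      have hb := fun i => hpos' _ _ (hocc x z hx i)
      have eQ : ∏ i, outZ p W (z i) = 2 ^ Q := by
        rw [hQ, ← hx]
        exact prod_eq_rpow_freq (zip3 u x z) (fun a => outZ p W a.2) fun i => (hb i).2.2.2.2
      have eS : ∏ i, S (u i) (z i) = 2 ^ Λ := by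
        rw [hΛ, ← hx]
        exact prod_eq_rpow_freq (zip3 u x z) (fun a => S a.1.1 a.2) fun i => (hb i).2.2.2.1
      rw [eQ, eS, ← Real.rpow_add two_pos, ← Real.rpow_mul two_pos.le]
      have e : Λ + (Γ * α + Q * (1 - α) - Λ) = Γ * α + Q * (1 - α) := by ring
      rw [e, Real.rpow_add two_pos, Real.rpow_mul two_pos.le Γ α]
      exact mul_le_mul_of_nonneg_right (Real.rpow_le_rpow (typeMass_nonneg hp hW ε u τ z)
        (hmass z) (by linarith)) (by positivity)
    · have h0 : typeMass p W ε u τ z = 0 :=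
        Finset.sum_eq_zero fun x _ => if_neg fun h => hx ⟨x, h.2⟩
      rw [h0, Real.zero_rpow (by linarith : α ≠ 0), zero_mul]
      exact hnn
  have hexp : Γ * α + Q * (1 - α) - Λ = n * ∑ a, τ a * letterExponent α p W t a.1 a.2 := by
    have : ∀ a, τ a * letterExponent α p W t a.1 a.2 = τ a * Real.logb 2 (φ a) * α +
        τ a * Real.logb 2 (outZ p W a.2) * (1 - α) - τ a * Real.logb 2 (S a.1.1 a.2) := by
      rintro ⟨s, z⟩
      by_cases h : τ (s, z) = 0
      · simp [h]
      · obtain ⟨-, h2, h3, h4, h5⟩ := hpos' s z h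
        simp only [hφ, letterExponent, ← hS]
        rw [Real.logb_div h3.ne' h2.ne', Real.logb_div h4.ne' h5.ne',
          Real.logb_div (mul_pos h2 h4).ne' h3.ne', Real.logb_mul h2.ne' h4.ne']
        ring
    simp only [this, Finset.sum_sub_distrib, Finset.sum_add_distrib, ← Finset.sum_mul, hΓ, hQ, hΛ]
    ring
  refine (Finset.sum_le_sum fun z _ => hpt z).trans ?_
  rw [← Finset.sum_mul, sum_prod_simplex (fun i => S (u i)) fun i => condZU_mem hp htm (hu i),
    one_mul, hexp]

/-- The power sum of the output measure given a sequence, in the conditionally typical case. -/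
theorem exists_sum_typicalOutput_rpow_le (hp : p ∈ stdSimplex ℝ (𝒰 × 𝒳))
    (hW : ∀ x, W x ∈ stdSimplex ℝ 𝒵) {α : ℝ} (hα : 1 < α) :
    ∃ G : ℝ, 0 ≤ G ∧ ∀ (ε : ℝ) (n : ℕ) (u : Fin n → 𝒰), (∀ i, margU p (u i) ≠ 0) →
      open Classical in
      ∑ z : Fin n → 𝒵, (∑ x : Fin n → 𝒳, if x ∈ typicalX p ε u then
          ∏ i, condXU p (u i) (x i) * W (x i) (z i) else 0) ^ α *
          (∏ i, outZ p W (z i)) ^ (1 - α) ≤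
        (((n + 1) ^ Fintype.card ((𝒰 × 𝒳) × 𝒵) : ℕ) : ℝ) ^ α *
          2 ^ (n * ((α - 1) * auxRate α p W + ε * G)) := by
  classical
  obtain ⟨G, hG0, hG⟩ := exists_exponent_le hp hW hα
  refine ⟨G, hG0, fun ε n u hu => ?_⟩
  set 𝒯 : Finset ((𝒰 × 𝒳) × 𝒵 → ℝ) := Finset.univ.image (freq : (Fin n → (𝒰 × 𝒳) × 𝒵) → _)
    with h𝒯
  set N : ℕ := (n + 1) ^ Fintype.card ((𝒰 × 𝒳) × 𝒵) with hN
  have hcard : (𝒯.card : ℝ) ≤ N := by exact_mod_cast card_image_freq_le ((𝒰 × 𝒳) × 𝒵) n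
  set E : ℝ := 2 ^ (n * ((α - 1) * auxRate α p W + ε * G)) with hE
  have hq0 : ∀ z : Fin n → 𝒵, 0 ≤ (∏ i, outZ p W (z i)) ^ (1 - α) := fun z =>
    Real.rpow_nonneg (Finset.prod_nonneg fun i _ => outZ_nonneg hp hW _) _
  have hsplit : ∀ z : Fin n → 𝒵, (∑ x : Fin n → 𝒳, if x ∈ typicalX p ε u then
      ∏ i, condXU p (u i) (x i) * W (x i) (z i) else 0) = ∑ τ ∈ 𝒯, typeMass p W ε u τ z := by
    intro z
    simp only [typeMass]
    rw [Finset.sum_comm]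
    refine Finset.sum_congr rfl fun x _ => ?_
    by_cases hx : x ∈ typicalX p ε u
    · simp [hx, h𝒯]
    · simp [hx]
  have hclass : ∀ τ ∈ 𝒯,
      ∑ z : Fin n → 𝒵, typeMass p W ε u τ z ^ α * (∏ i, outZ p W (z i)) ^ (1 - α) ≤ E := by
    intro τ hτ
    -- A type with no realisation of positive mass contributes nothing. A positive realisation shows
    -- that `τ` lives on the support of `p` and `W`.
    by_cases hex : ∃ (x : Fin n → 𝒳) (z : Fin n → 𝒵), x ∈ typicalX p ε u ∧
        freq (zip3 u x z) = τ ∧ ∏ i, condXU p (u i) (x i) * W (x i) (z i) ≠ 0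
    · obtain ⟨x, z, hx, hxz, hne⟩ := hex
      have hτ0 : ∀ a, 0 ≤ τ a := fun a => hxz ▸ freq_nonneg _ a
      have hfac : ∀ i, p (u i, x i) ≠ 0 ∧ W (x i) (z i) ≠ 0 := by
        intro i
        have := Finset.prod_ne_zero_iff.1 hne i (Finset.mem_univ i)
        refine ⟨fun h => this ?_, right_ne_zero_of_mul this⟩
        simp [condXU, h]
      have hpos : ∀ s z, τ (s, z) ≠ 0 → p s ≠ 0 ∧ W s.2 z ≠ 0 := by
        intro s z' h
        rw [← hxz] at h
        obtain ⟨i, hi⟩ := exists_of_freq_ne_zero h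
        have h1 := congrArg Prod.fst hi
        have h2 := congrArg Prod.snd hi
        simp only [zip3] at h1 h2
        rw [← h1, ← h2]
        exact hfac i
      have hmarg : ∀ s, ∑ z', τ (s, z') = freq (fun i => (u i, x i)) s := by
        intro s
        rw [← hxz]
        exact (freq_fst (fun i => (u i, x i)) z s).symm
      refine (sum_typeMass_rpow_le hp hW hα ε hu hτ0 hpos).trans ?_
      refine Real.rpow_le_rpow_of_exponent_le one_le_two
        (mul_le_mul_of_nonneg_left ?_ n.cast_nonneg)
      -- Completing unobserved rows by `W` itself keeps the divergence from `W` finite.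
      have hmem : typeChannel W τ ∈ auxChannels p W := by
        refine ⟨typeChannel_mem hW hτ0, fun u' x' z' _ hz => ?_⟩
        rw [typeChannel]
        split_ifs
        · exact hz
        · have : τ ((u', x'), z') = 0 := by
            by_contra h
            exact (hpos _ _ h).2 hz
          rw [this, zero_div]
      have := hG _ hmem (freq fun i => (u i, x i)) ε (fun s => hx s.1 s.2) (by
        intro s hs
        rw [← hmarg]
        refine Finset.sum_eq_zero fun z' _ => ?_
        by_contra h
        exact (hpos _ _ h).1 hs)
      refine le_trans (le_of_eq ?_) this
      rw [Fintype.sum_prod_type]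
      refine Finset.sum_congr rfl fun s _ => ?_
      rw [Finset.mul_sum]
      refine Finset.sum_congr rfl fun z' _ => ?_
      rw [← hmarg, ← mul_assoc, sum_mul_typeChannel hτ0]
    · push Not at hex
      have h0 : ∀ z, typeMass p W ε u τ z = 0 := by
        intro z
        refine Finset.sum_eq_zero fun x _ => ?_
        split_ifs with h
        · exact hex x z h.1 h.2
        · rfl
      simp only [h0, Real.zero_rpow (by linarith : α ≠ 0), zero_mul, Finset.sum_const_zero]
      positivity
  calc _ = ∑ z : Fin n → 𝒵, (∑ τ ∈ 𝒯, typeMass p W ε u τ z) ^ α *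
        (∏ i, outZ p W (z i)) ^ (1 - α) := by simp only [hsplit]
    _ ≤ ∑ z : Fin n → 𝒵, ((𝒯.card : ℝ) ^ (α - 1) * ∑ τ ∈ 𝒯, typeMass p W ε u τ z ^ α) *
        (∏ i, outZ p W (z i)) ^ (1 - α) :=
        Finset.sum_le_sum fun z _ => mul_le_mul_of_nonneg_right
          (Real.rpow_sum_le_const_mul_sum_rpow_of_nonneg 𝒯 hα.le
            fun τ _ => typeMass_nonneg hp hW ε u τ z) (hq0 z)
    _ = (𝒯.card : ℝ) ^ (α - 1) * ∑ τ ∈ 𝒯, ∑ z : Fin n → 𝒵, typeMass p W ε u τ z ^ α *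
        (∏ i, outZ p W (z i)) ^ (1 - α) := by
        rw [Finset.sum_comm, Finset.mul_sum]
        refine Finset.sum_congr rfl fun z _ => ?_
        rw [mul_assoc, Finset.sum_mul]
    _ ≤ (𝒯.card : ℝ) ^ (α - 1) * ∑ τ ∈ 𝒯, E :=
        mul_le_mul_of_nonneg_left (Finset.sum_le_sum hclass) (by positivity)
    _ = (𝒯.card : ℝ) ^ α * E := by
        rw [Finset.sum_const, nsmul_eq_mul, ← mul_assoc, mul_comm _ (𝒯.card : ℝ),
          mul_rpow_sub_one (Nat.cast_nonneg _) (by linarith)]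
    _ ≤ (N : ℝ) ^ α * E := mul_le_mul_of_nonneg_right
        (Real.rpow_le_rpow (Nat.cast_nonneg _) hcard (by linarith)) (by positivity)

end Types

/-! ### The restricted input law and its output masses -/

section Input

variable {𝒰 𝒳 𝒵 : Type*} [Fintype 𝒰] [Fintype 𝒳] {p : 𝒰 × 𝒳 → ℝ} {W : 𝒳 → 𝒵 → ℝ}
  {n : ℕ} {ε a : ℝ}

open Classical in
/-- The typical sets have probability at least `a`. -/
def TypicalProbGE (p : 𝒰 × 𝒳 → ℝ) (ε : ℝ) (n : ℕ) (a : ℝ) : Prop :=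
  a ≤ (∑ v : Fin n → 𝒰, if v ∈ typicalU p ε n then ∏ i, margU p (v i) else 0) ∧
    ∀ u ∈ typicalU p ε n, (∀ i, margU p (u i) ≠ 0) →
      a ≤ ∑ y : Fin n → 𝒳, if y ∈ typicalX p ε u then ∏ i, condXU p (u i) (y i) else 0

theorem typicalProbGE (hp : p ∈ stdSimplex ℝ (𝒰 × 𝒳)) (hn : 0 < n) (hε : 0 < ε) :
    TypicalProbGE p ε n
      (1 - (Fintype.card 𝒰 + Fintype.card (𝒰 × 𝒳) : ℝ) / (n * ε ^ 2)) := by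
  have h1 : 0 ≤ (Fintype.card 𝒰 : ℝ) / (n * ε ^ 2) := by positivity
  have h2 : 0 ≤ (Fintype.card (𝒰 × 𝒳) : ℝ) / (n * ε ^ 2) := by positivity
  rw [add_div]
  exact ⟨le_trans (by linarith) (one_sub_le_sum_typicalU hp hn hε),
    fun u hu hu0 => le_trans (by linarith) (one_sub_le_sum_typicalX hp hn hε hu hu0)⟩

theorem typicalPMF_nonneg (hp : p ∈ stdSimplex ℝ (𝒰 × 𝒳)) (u : Fin n → 𝒰) (x : Fin n → 𝒳) :
    0 ≤ typicalPMF p ε n u x := by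
  have hU : ∀ v : Fin n → 𝒰, 0 ≤ ∏ i, margU p (v i) := fun v =>
    Finset.prod_nonneg fun i _ => margU_nonneg hp _
  have hX : ∀ y : Fin n → 𝒳, 0 ≤ ∏ i, condXU p (u i) (y i) := fun y =>
    Finset.prod_nonneg fun i _ => condXU_nonneg hp _ _
  unfold typicalPMF
  split_ifs
  · refine div_nonneg (Finset.prod_nonneg fun i _ =>
      mul_nonneg (margU_nonneg hp _) (condXU_nonneg hp _ _)) (mul_nonneg ?_ ?_)
    · exact Finset.sum_nonneg fun v _ => by split_ifs <;> simp [hU]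
    · exact Finset.sum_nonneg fun v _ => by split_ifs <;> simp [hX]
  · exact le_rfl

theorem typicalPMF_eq_zero {u : Fin n → 𝒰} (x : Fin n → 𝒳)
    (h : ¬(u ∈ typicalU p ε n ∧ ∀ i, margU p (u i) ≠ 0)) : typicalPMF p ε n u x = 0 := by
  unfold typicalPMF
  split_ifs with hux
  · have : ∃ i, margU p (u i) = 0 := by
      by_contra! hc
      exact h ⟨hux.1, hc⟩
    obtain ⟨i, hi⟩ := this
    rw [Finset.prod_eq_zero (Finset.mem_univ i) (by rw [hi, zero_mul]), zero_div]
  · rfl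

open Classical in
theorem typicalPMF_le (hp : p ∈ stdSimplex ℝ (𝒰 × 𝒳)) (ha : 0 < a) (hT : TypicalProbGE p ε n a)
    (u : Fin n → 𝒰) (x : Fin n → 𝒳) :
    typicalPMF p ε n u x ≤ (a ^ 2)⁻¹ * ((∏ i, margU p (u i)) *
      if x ∈ typicalX p ε u then ∏ i, condXU p (u i) (x i) else 0) := by
  have hU : 0 ≤ ∏ i, margU p (u i) := Finset.prod_nonneg fun i _ => margU_nonneg hp _
  have hX : 0 ≤ ∏ i, condXU p (u i) (x i) := Finset.prod_nonneg fun i _ => condXU_nonneg hp _ _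
  have hnn : 0 ≤ (a ^ 2)⁻¹ * ((∏ i, margU p (u i)) *
      if x ∈ typicalX p ε u then ∏ i, condXU p (u i) (x i) else 0) := by
    split_ifs <;> positivity
  by_cases h : u ∈ typicalU p ε n ∧ ∀ i, margU p (u i) ≠ 0
  · have h2 := hT.2 u h.1 h.2
    by_cases hx : x ∈ typicalX p ε u
    · rw [typicalPMF, if_pos ⟨h.1, hx⟩, if_pos hx, Finset.prod_mul_distrib, div_eq_inv_mul]
      refine mul_le_mul_of_nonneg_right (inv_anti₀ (by positivity) ?_) (by positivity)
      rw [sq]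
      exact mul_le_mul hT.1 h2 ha.le (ha.le.trans hT.1)
    · rw [typicalPMF, if_neg fun h => hx h.2]
      exact hnn
  · rw [typicalPMF_eq_zero x h]
    exact hnn

/-- For fixed `u` the inner normaliser cancels. Typical `u` containing a letter of probability zero
must be treated apart, because there the inner normaliser is not bounded below; they carry no mass.
-/
theorem sum_typicalPMF (ha : 0 < a) (hT : TypicalProbGE p ε n a) :
    ∑ u : Fin n → 𝒰, ∑ x : Fin n → 𝒳, typicalPMF p ε n u x = 1 := by
  classical
  have hA := ha.trans_le hT.1
  set A := ∑ v : Fin n → 𝒰, if v ∈ typicalU p ε n then ∏ i, margU p (v i) else 0 with hAdef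
  have h : ∀ u : Fin n → 𝒰, ∑ x : Fin n → 𝒳, typicalPMF p ε n u x =
      (if u ∈ typicalU p ε n then ∏ i, margU p (u i) else 0) / A := by
    intro u
    by_cases h : u ∈ typicalU p ε n ∧ ∀ i, margU p (u i) ≠ 0
    · have hD := ha.trans_le (hT.2 u h.1 h.2)
      rw [if_pos h.1]
      set D := ∑ y : Fin n → 𝒳, if y ∈ typicalX p ε u then ∏ i, condXU p (u i) (y i) else 0
        with hDdef
      have hx : ∀ x : Fin n → 𝒳, typicalPMF p ε n u x = (∏ i, margU p (u i)) / (A * D) *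
          if x ∈ typicalX p ε u then ∏ i, condXU p (u i) (x i) else 0 := by
        intro x
        unfold typicalPMF
        by_cases hx : x ∈ typicalX p ε u
        · rw [if_pos ⟨h.1, hx⟩, if_pos hx, Finset.prod_mul_distrib, div_mul_eq_mul_div]
        · rw [if_neg fun h => hx h.2, if_neg hx, mul_zero]
      simp only [hx]
      rw [← Finset.mul_sum, ← hDdef]
      field_simp
    · rw [Finset.sum_eq_zero fun x _ => typicalPMF_eq_zero x h]
      by_cases hu : u ∈ typicalU p ε n
      · have : ∃ i, margU p (u i) = 0 := by
          by_contra! hc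
          exact h ⟨hu, hc⟩
        obtain ⟨i, hi⟩ := this
        rw [if_pos hu, Finset.prod_eq_zero (Finset.mem_univ i) hi, zero_div]
      · rw [if_neg hu, zero_div]
  simp only [h]
  rw [← Finset.sum_div, ← hAdef, div_self hA.ne']

/-- The exponent is linear in the type of `u`, which is within `ε` of `p(u)` letter by letter. -/
theorem prod_margU_le (hp : p ∈ stdSimplex ℝ (𝒰 × 𝒳)) {u : Fin n → 𝒰} (hu : u ∈ typicalU p ε n)
    (hu0 : ∀ i, margU p (u i) ≠ 0) :
    ∏ i, margU p (u i) ≤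
      2 ^ (-(n * (entropy (margU p) - ε * ∑ b, |Real.logb 2 (margU p b)|))) := by
  rw [prod_eq_rpow_freq u (margU p) fun i => lt_of_le_of_ne (margU_nonneg hp _) (hu0 i).symm,
    ← mul_neg]
  refine Real.rpow_le_rpow_of_exponent_le one_le_two
    (mul_le_mul_of_nonneg_left ?_ n.cast_nonneg)
  rw [entropy, neg_sub, sub_neg_eq_add, Finset.mul_sum, ← Finset.sum_add_distrib]
  refine Finset.sum_le_sum fun b _ => ?_
  have : (freq u b - margU p b) * Real.logb 2 (margU p b) ≤ ε * |Real.logb 2 (margU p b)| := by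
    refine (le_abs_self _).trans ?_
    rw [abs_mul]
    exact mul_le_mul_of_nonneg_right (hu b).le (abs_nonneg _)
  linarith

/-- The joint mass of the input sequence `u` and the output sequence `z`. -/
noncomputable def outMass (p : 𝒰 × 𝒳 → ℝ) (W : 𝒳 → 𝒵 → ℝ) (ε : ℝ) (u : Fin n → 𝒰)
    (z : Fin n → 𝒵) : ℝ :=
  ∑ x : Fin n → 𝒳, typicalPMF p ε n u x * ∏ i, W (x i) (z i)

open Classical in
theorem binnedLaw_eq_sum_outMass {M : ℕ} (B : (Fin n → 𝒰) → Fin M) (c : Fin M × (Fin n → 𝒵)) :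
    binnedLaw p W ε B c = ∑ u, outMass p W ε u c.2 * if B u = c.1 then 1 else 0 := by
  unfold binnedLaw outMass
  refine Finset.sum_congr rfl fun u _ => ?_
  rw [Finset.sum_mul]
  exact Finset.sum_congr rfl fun x _ => by ring

variable [Fintype 𝒵]

theorem prod_channel_nonneg {𝒳 𝒵 : Type*} [Fintype 𝒵] {W : 𝒳 → 𝒵 → ℝ}
    (hW : ∀ x, W x ∈ stdSimplex ℝ 𝒵) (x : Fin n → 𝒳) (z : Fin n → 𝒵) :
    0 ≤ ∏ i, W (x i) (z i) :=
  Finset.prod_nonneg fun _ _ => (hW _).1 _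

theorem prod_outZ_nonneg (hp : p ∈ stdSimplex ℝ (𝒰 × 𝒳)) (hW : ∀ x, W x ∈ stdSimplex ℝ 𝒵)
    (z : Fin n → 𝒵) : 0 ≤ ∏ i, outZ p W (z i) :=
  Finset.prod_nonneg fun _ _ => outZ_nonneg hp hW _

theorem outMass_nonneg (hp : p ∈ stdSimplex ℝ (𝒰 × 𝒳)) (hW : ∀ x, W x ∈ stdSimplex ℝ 𝒵)
    (u : Fin n → 𝒰) (z : Fin n → 𝒵) : 0 ≤ outMass p W ε u z :=
  Finset.sum_nonneg fun x _ => mul_nonneg (typicalPMF_nonneg hp u x) (prod_channel_nonneg hW x z)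

open Classical in
theorem outMass_le (hp : p ∈ stdSimplex ℝ (𝒰 × 𝒳)) (hW : ∀ x, W x ∈ stdSimplex ℝ 𝒵)
    (ha : 0 < a) (hT : TypicalProbGE p ε n a) (u : Fin n → 𝒰) (z : Fin n → 𝒵) :
    outMass p W ε u z ≤ (a ^ 2)⁻¹ * ((∏ i, margU p (u i)) *
      ∑ x : Fin n → 𝒳, if x ∈ typicalX p ε u then
        ∏ i, condXU p (u i) (x i) * W (x i) (z i) else 0) := by
  rw [outMass, Finset.mul_sum, Finset.mul_sum]
  refine Finset.sum_le_sum fun x _ => ?_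
  refine (mul_le_mul_of_nonneg_right (typicalPMF_le hp ha hT u x)
    (prod_channel_nonneg hW x z)).trans (le_of_eq ?_)
  split_ifs
  · rw [Finset.prod_mul_distrib]
    ring
  · simp

/-- Dropping the typicality constraints only enlarges the sum and leaves the memoryless law, whose
output is `q`; the price is the normalisation factor. -/
theorem sum_outMass_le (hp : p ∈ stdSimplex ℝ (𝒰 × 𝒳)) (hW : ∀ x, W x ∈ stdSimplex ℝ 𝒵)
    (ha : 0 < a) (hT : TypicalProbGE p ε n a) (z : Fin n → 𝒵) :
    ∑ u : Fin n → 𝒰, outMass p W ε u z ≤ (a ^ 2)⁻¹ * ∏ i, outZ p W (z i) := by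
  classical
  have h1 : ∀ u : Fin n → 𝒰, outMass p W ε u z ≤
      (a ^ 2)⁻¹ * ∏ i, ∑ x, p (u i, x) * W x (z i) := by
    intro u
    refine (outMass_le hp hW ha hT u z).trans (mul_le_mul_of_nonneg_left ?_ (by positivity))
    calc _ ≤ (∏ i, margU p (u i)) * ∑ x : Fin n → 𝒳, ∏ i, condXU p (u i) (x i) * W (x i) (z i) := by
          refine mul_le_mul_of_nonneg_left (Finset.sum_le_sum fun x _ => ?_)
            (Finset.prod_nonneg fun i _ => margU_nonneg hp _)
          split_ifs
          · exact le_rfl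
          · exact Finset.prod_nonneg fun i _ => mul_nonneg (condXU_nonneg hp _ _) ((hW _).1 _)
      _ = _ := by
          rw [sum_prod_pi (fun i x => condXU p (u i) x * W x (z i)), ← Finset.prod_mul_distrib]
          refine Finset.prod_congr rfl fun i _ => ?_
          rw [Finset.mul_sum]
          exact Finset.sum_congr rfl fun x _ => by rw [← mul_assoc, margU_mul_condXU hp]
  refine (Finset.sum_le_sum fun u _ => h1 u).trans (le_of_eq ?_)
  rw [← Finset.mul_sum, sum_prod_pi (fun i u => ∑ x, p (u, x) * W x (z i))]
  congr 1
  refine Finset.prod_congr rfl fun i _ => ?_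
  simp only [outZ, margX, Finset.sum_mul]
  exact Finset.sum_comm

theorem rpow_mul_rpow_one_sub {x α : ℝ} (hx : 0 ≤ x) (hα : 0 < α) : x ^ α * x ^ (1 - α) = x := by
  rcases hx.eq_or_lt with rfl | hx
  · rw [Real.zero_rpow hα.ne', zero_mul]
  · rw [← Real.rpow_add hx, add_sub_cancel, Real.rpow_one]

theorem sum_output_rpow_le (hp : p ∈ stdSimplex ℝ (𝒰 × 𝒳)) (hW : ∀ x, W x ∈ stdSimplex ℝ 𝒵)
    {α : ℝ} (hα : 1 < α) (ha : 0 < a) (hT : TypicalProbGE p ε n a) :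
    ∑ z : Fin n → 𝒵, (∑ u : Fin n → 𝒰, outMass p W ε u z) ^ α *
      (∏ i, outZ p W (z i)) ^ (1 - α) ≤ (a ^ 2)⁻¹ ^ α := by
  calc _ ≤ ∑ z : Fin n → 𝒵, (a ^ 2)⁻¹ ^ α * ∏ i, outZ p W (z i) := by
        refine Finset.sum_le_sum fun z _ => ?_
        have hq := prod_outZ_nonneg hp hW z
        calc _ ≤ ((a ^ 2)⁻¹ * ∏ i, outZ p W (z i)) ^ α * (∏ i, outZ p W (z i)) ^ (1 - α) :=
              mul_le_mul_of_nonneg_right (Real.rpow_le_rpow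
                (Finset.sum_nonneg fun u _ => outMass_nonneg hp hW u z)
                (sum_outMass_le hp hW ha hT z) (by linarith)) (Real.rpow_nonneg hq _)
          _ = _ := by
              rw [Real.mul_rpow (by positivity) hq, mul_assoc,
                rpow_mul_rpow_one_sub hq (by linarith)]
    _ = _ := by
        rw [← Finset.mul_sum, sum_prod_simplex (fun _ => outZ p W) fun _ => outZ_mem hp hW,
          mul_one]

theorem exists_sum_outMass_rpow_le (hp : p ∈ stdSimplex ℝ (𝒰 × 𝒳))
    (hW : ∀ x, W x ∈ stdSimplex ℝ 𝒵) {α : ℝ} (hα : 1 < α) :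
    ∃ G : ℝ, 0 ≤ G ∧ ∀ (ε : ℝ) (n : ℕ) (a : ℝ), 0 < a → TypicalProbGE p ε n a →
      ∑ u : Fin n → 𝒰, ∑ z : Fin n → 𝒵, outMass p W ε u z ^ α *
        (∏ i, outZ p W (z i)) ^ (1 - α) ≤
      (a ^ 2)⁻¹ ^ α * (((n + 1) ^ Fintype.card ((𝒰 × 𝒳) × 𝒵) : ℕ) : ℝ) ^ α *
        2 ^ (n * ((α - 1) * (auxRate α p W - entropy (margU p)) + ε * G)) := by
  classical
  obtain ⟨G, hG0, hG⟩ := exists_sum_typicalOutput_rpow_le hp hW hα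
  set K := ∑ b, |Real.logb 2 (margU p b)| with hK
  refine ⟨(α - 1) * K + G, add_nonneg (mul_nonneg (by linarith)
    (Finset.sum_nonneg fun b _ => abs_nonneg _)) hG0, fun ε n a ha hT => ?_⟩
  set N : ℝ := (((n + 1) ^ Fintype.card ((𝒰 × 𝒳) × 𝒵) : ℕ) : ℝ) ^ α with hN
  have hN0 : 0 ≤ N := by positivity
  set E : ℝ := 2 ^ (n * ((α - 1) * (auxRate α p W - entropy (margU p)) +
    ε * ((α - 1) * K + G))) with hE
  have hpt : ∀ u : Fin n → 𝒰, ∑ z : Fin n → 𝒵, outMass p W ε u z ^ α *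
      (∏ i, outZ p W (z i)) ^ (1 - α) ≤ (∏ i, margU p (u i)) * ((a ^ 2)⁻¹ ^ α * N * E) := by
    intro u
    have hU : 0 ≤ ∏ i, margU p (u i) := Finset.prod_nonneg fun i _ => margU_nonneg hp _
    by_cases h : u ∈ typicalU p ε n ∧ ∀ i, margU p (u i) ≠ 0
    · set w : (Fin n → 𝒵) → ℝ := fun z => ∑ x : Fin n → 𝒳, if x ∈ typicalX p ε u then
        ∏ i, condXU p (u i) (x i) * W (x i) (z i) else 0 with hw
      have hw0 : ∀ z, 0 ≤ w z := fun z => Finset.sum_nonneg fun x _ => by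
        split_ifs
        · exact Finset.prod_nonneg fun i _ => mul_nonneg (condXU_nonneg hp _ _) ((hW _).1 _)
        · exact le_rfl
      calc _ ≤ ∑ z : Fin n → 𝒵, ((a ^ 2)⁻¹ * ((∏ i, margU p (u i)) * w z)) ^ α *
              (∏ i, outZ p W (z i)) ^ (1 - α) :=
            Finset.sum_le_sum fun z _ => mul_le_mul_of_nonneg_right
              (Real.rpow_le_rpow (outMass_nonneg hp hW u z) (outMass_le hp hW ha hT u z)
                (by linarith)) (Real.rpow_nonneg (prod_outZ_nonneg hp hW z) _)
        _ = (a ^ 2)⁻¹ ^ α * (∏ i, margU p (u i)) ^ α *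
              ∑ z : Fin n → 𝒵, w z ^ α * (∏ i, outZ p W (z i)) ^ (1 - α) := by
            rw [Finset.mul_sum]
            refine Finset.sum_congr rfl fun z _ => ?_
            rw [Real.mul_rpow (by positivity) (mul_nonneg hU (hw0 z)), Real.mul_rpow hU (hw0 z)]
            ring
        _ ≤ (a ^ 2)⁻¹ ^ α * (∏ i, margU p (u i)) ^ α *
              (N * 2 ^ (n * ((α - 1) * auxRate α p W + ε * G))) :=
            mul_le_mul_of_nonneg_left (hG ε n u h.2)
              (mul_nonneg (by positivity) (Real.rpow_nonneg hU _))
        -- One factor `p(u)` is kept as a weight that later sums to one; the other `α - 1` powers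
        -- supply the entropy term.
        _ = (∏ i, margU p (u i)) * ((a ^ 2)⁻¹ ^ α * N * ((∏ i, margU p (u i)) ^ (α - 1) *
              2 ^ (n * ((α - 1) * auxRate α p W + ε * G)))) := by
            rw [← mul_rpow_sub_one hU (by linarith : 0 < α)]
            ring
        _ ≤ (∏ i, margU p (u i)) * ((a ^ 2)⁻¹ ^ α * N *
              ((2 ^ (-(n * (entropy (margU p) - ε * K)))) ^ (α - 1) *
                2 ^ (n * ((α - 1) * auxRate α p W + ε * G)))) := by
            have := Real.rpow_le_rpow hU (prod_margU_le hp h.1 h.2) (by linarith : 0 ≤ α - 1)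
            gcongr
        _ = _ := by
            rw [← Real.rpow_mul two_pos.le, ← Real.rpow_add two_pos, hE]
            congr 3
            ring
    · have h0 : ∀ z : Fin n → 𝒵, outMass p W ε u z = 0 := fun z =>
        Finset.sum_eq_zero fun x _ => by rw [typicalPMF_eq_zero x h, zero_mul]
      simp only [h0, Real.zero_rpow (by linarith : α ≠ 0), zero_mul, Finset.sum_const_zero]
      positivity
  refine (Finset.sum_le_sum fun u _ => hpt u).trans (le_of_eq ?_)
  rw [← Finset.sum_mul, sum_prod_simplex (fun _ => margU p) fun _ => margU_mem hp, one_mul]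

theorem sum_prod_channel {𝒳 𝒵 : Type*} [Fintype 𝒵] {W : 𝒳 → 𝒵 → ℝ}
    (hW : ∀ x, W x ∈ stdSimplex ℝ 𝒵) (x : Fin n → 𝒳) :
    ∑ z : Fin n → 𝒵, ∏ i, W (x i) (z i) = 1 :=
  sum_prod_simplex (fun i => W (x i)) fun i => hW (x i)

theorem binnedLaw_mem (hp : p ∈ stdSimplex ℝ (𝒰 × 𝒳)) (hW : ∀ x, W x ∈ stdSimplex ℝ 𝒵)
    (ha : 0 < a) (hT : TypicalProbGE p ε n a) {M : ℕ} (B : (Fin n → 𝒰) → Fin M) :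
    binnedLaw p W ε B ∈ stdSimplex ℝ (Fin M × (Fin n → 𝒵)) := by
  classical
  refine ⟨fun c => ?_, ?_⟩
  · rw [binnedLaw_eq_sum_outMass]
    exact Finset.sum_nonneg fun u _ => mul_nonneg (outMass_nonneg hp hW u _)
      (by split_ifs <;> simp)
  · simp only [binnedLaw_eq_sum_outMass]
    rw [Finset.sum_comm]
    refine (Finset.sum_congr rfl fun u _ => ?_).trans (sum_typicalPMF ha hT)
    rw [Fintype.sum_prod_type_right]
    have hb : ∀ z, ∑ b, outMass p W ε u z * (if B u = b then 1 else 0) = outMass p W ε u z :=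
      fun z => by simp
    simp only [hb]
    simp only [outMass]
    rw [Finset.sum_comm]
    simp only [← Finset.mul_sum, sum_prod_channel hW, mul_one]

theorem idealLaw_mem (hp : p ∈ stdSimplex ℝ (𝒰 × 𝒳)) (hW : ∀ x, W x ∈ stdSimplex ℝ 𝒵)
    {M : ℕ} (hM : 0 < M) :
    (idealLaw p W : Fin M × (Fin n → 𝒵) → ℝ) ∈ stdSimplex ℝ (Fin M × (Fin n → 𝒵)) := by
  refine ⟨fun c => ?_, ?_⟩
  · rw [idealLaw]
    exact mul_nonneg (by positivity) (prod_outZ_nonneg hp hW _)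
  simp only [idealLaw, Fintype.sum_prod_type, ← Finset.mul_sum]
  rw [sum_prod_simplex (fun _ => outZ p W) fun _ => outZ_mem hp hW]
  simp only [mul_one, Finset.sum_const, Finset.card_univ, Fintype.card_fin, nsmul_eq_mul]
  exact one_div_mul_cancel (G₀ := ℝ) (Nat.cast_ne_zero.2 hM.ne')

/-! ### Two-sided bounds for the expected divergence -/

theorem binningExp_tsallisDiv_nonneg (hp : p ∈ stdSimplex ℝ (𝒰 × 𝒳))
    (hW : ∀ x, W x ∈ stdSimplex ℝ 𝒵) {α : ℝ} (hα : 1 < α) (ha : 0 < a)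
    (hT : TypicalProbGE p ε n a) {M : ℕ} (hM : 0 < M) :
    0 ≤ binningExp 𝒰 n M fun B => tsallisDiv α (binnedLaw p W ε B) (idealLaw p W) :=
  Finset.sum_nonneg fun B _ => mul_nonneg (Finset.prod_nonneg fun _ _ => by positivity)
    (tsallisDiv_nonneg hα (binnedLaw_mem hp hW ha hT B) (idealLaw_mem hp hW hM)
      fun c => binnedLaw_eq_zero hp hW ε B c)

theorem binningExp_tsallisDiv_le (hp : p ∈ stdSimplex ℝ (𝒰 × 𝒳))
    (hW : ∀ x, W x ∈ stdSimplex ℝ 𝒵) {α δ C : ℝ} (hα : 1 < α) (hδ : 0 < δ)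
    (hC : ∀ x y : ℝ, 0 ≤ x → 0 ≤ y →
      (x + y) ^ (α - 1) ≤ (1 + δ) * y ^ (α - 1) + C * x ^ (α - 1))
    (ha : 0 < a) (hT : TypicalProbGE p ε n a) {M : ℕ} (hM : 0 < M) :
    (1 - δ * (α - 1)) * (1 + (α - 1) *
        binningExp 𝒰 n M fun B => tsallisDiv α (binnedLaw p W ε B) (idealLaw p W)) ≤
      (1 + δ) * (a ^ 2)⁻¹ ^ α + α * C * ((M : ℝ) ^ (α - 1) *
        ∑ u : Fin n → 𝒰, ∑ z : Fin n → 𝒵, outMass p W ε u z ^ α *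
          (∏ i, outZ p W (z i)) ^ (1 - α)) := by
  classical
  have hM' : (M : ℝ) ≠ 0 := by positivity
  have hα1 : α - 1 ≠ 0 := by linarith
  have hw : ∑ _B : (Fin n → 𝒰) → Fin M, (∏ _u : Fin n → 𝒰, (1 / M : ℝ)) = 1 := by
    simp only [Finset.prod_const, Finset.sum_const, Finset.card_univ, Fintype.card_fun (β := Fin M),
      Fintype.card_fin, nsmul_eq_mul, Nat.cast_pow]
    rw [← mul_pow, mul_one_div_cancel hM', one_pow]
  have h1 := sum_binned_rpow_le hα hδ hC hM (fun (u : Fin n → 𝒰) (z : Fin n → 𝒵) =>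
    outMass p W ε u z) (outMass_nonneg hp hW) (fun z => ∏ i, outZ p W (z i))
    (prod_outZ_nonneg hp hW)
  have e : 1 + (α - 1) * (binningExp 𝒰 n M fun B =>
      tsallisDiv α (binnedLaw p W ε B) (idealLaw p W)) =
      ∑ B : (Fin n → 𝒰) → Fin M, (∏ _u : Fin n → 𝒰, (1 / M : ℝ)) *
        ∑ c : Fin M × (Fin n → 𝒵), (∑ u, outMass p W ε u c.2 * if B u = c.1 then 1 else 0) ^ α *
          (1 / M * ∏ i, outZ p W (c.2 i)) ^ (1 - α) := by
    have h2 : ∀ x y : ℝ, (α - 1) * (x * (1 / (α - 1) * (y - 1))) = x * y - x := by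
      intro x y
      field_simp
    rw [binningExp, Finset.mul_sum]
    simp only [tsallisDiv, h2, Finset.sum_sub_distrib]
    simp only [binnedLaw_eq_sum_outMass, idealLaw]
    rw [hw]
    exact add_sub_cancel _ _
  rw [e]
  refine h1.trans (add_le_add_left (mul_le_mul_of_nonneg_left
    (sum_output_rpow_le hp hW hα ha hT) (by linarith)) _)

end Input

/-! ### Exponential decay and choice of constants -/

section Limit

theorem tendsto_poly_mul_exp (d : ℕ) (α : ℝ) {θ : ℝ} (hθ : 0 < θ) :
    Tendsto (fun n : ℕ => (((n + 1) ^ d : ℕ) : ℝ) ^ α * 2 ^ (n * -θ)) atTop (𝓝 0) := by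
  have hb : 0 < θ * Real.log 2 := mul_pos hθ (Real.log_pos one_lt_two)
  have h1 := tendsto_rpow_mul_exp_neg_mul_atTop_nhds_zero (d * α) (θ * Real.log 2) hb
  -- The known limit is taken at `n + 1`; the constant factor undoes the shift in the exponential.
  have h2 := (h1.comp (tendsto_natCast_atTop_atTop.comp (tendsto_add_atTop_nat 1))).const_mul
    (Real.exp (θ * Real.log 2))
  rw [mul_zero] at h2
  refine h2.congr fun n => ?_
  simp only [Function.comp_apply]
  have h0 : (0 : ℝ) ≤ ((n + 1 : ℕ) : ℝ) := Nat.cast_nonneg _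
  rw [Nat.cast_pow, ← Real.rpow_natCast, ← Real.rpow_mul h0, Real.rpow_def_of_pos two_pos,
    mul_left_comm, ← Real.exp_add]
  congr 2
  push_cast
  ring

/-- At `δ = 0` the inequalities are strict, so they persist for small positive `δ` by continuity. -/
theorem exists_slack {α η : ℝ} (hα : 1 < α) (hη : 0 < η) :
    ∃ δ : ℝ, 0 < δ ∧ 0 < 1 - δ * (α - 1) ∧ 1 + δ < (1 - δ * (α - 1)) * (1 + (α - 1) * η) := by
  have h1 : 0 < α - 1 := by linarith
  have hc : ContinuousAt (fun δ : ℝ => (1 - δ * (α - 1)) * (1 + (α - 1) * η) - (1 + δ)) 0 := by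
    fun_prop
  have hc' : ContinuousAt (fun δ : ℝ => 1 - δ * (α - 1)) 0 := by fun_prop
  have e1 := hc.eventually (lt_mem_nhds (a := 0) (by simpa using mul_pos h1 hη))
  have e2 := hc'.eventually (lt_mem_nhds (a := 0) (by simp))
  have e3 : ∀ᶠ δ in 𝓝[>] (0 : ℝ), 0 < δ := eventually_mem_nhdsWithin
  obtain ⟨δ, ⟨h2, h3⟩, h4⟩ := (((e1.and e2).filter_mono nhdsWithin_le_nhds).and e3).exists
  exact ⟨δ, h4, h3, by linarith⟩

end Limit

end StochasticBinning

/-! ### Conclusion: the exponent is negative and the limit follows -/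

theorem mainTheorem5 {𝒰 𝒳 𝒵 : Type*} [Fintype 𝒰] [Fintype 𝒳] [Fintype 𝒵]
    (p : 𝒰 × 𝒳 → ℝ) (hp : p ∈ stdSimplex ℝ (𝒰 × 𝒳))
    (W : 𝒳 → 𝒵 → ℝ) (hW : ∀ x, W x ∈ stdSimplex ℝ 𝒵)
    (α : ℝ) (hα : 1 < α) (R : ℝ) (hR0 : 0 ≤ R)
    (hR : R < StochasticBinning.entropy (StochasticBinning.margU p)
      - StochasticBinning.auxRate α p W) :
    ∃ ε₀ > 0, ∀ ε : ℝ, 0 < ε → ε < ε₀ →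
      Tendsto
        (fun n : ℕ =>
          StochasticBinning.binningExp 𝒰 n ⌊(2 : ℝ) ^ ((n : ℝ) * R)⌋₊ fun B =>
            StochasticBinning.tsallisDiv α
              (StochasticBinning.binnedLaw p W ε B) (StochasticBinning.idealLaw p W))
        atTop (𝓝 0) := by
  open StochasticBinning in
  have hα1 : 0 < α - 1 := by linarith
  obtain ⟨G, hG0, hG⟩ := exists_sum_outMass_rpow_le hp hW hα
  set gap := entropy (margU p) - auxRate α p W - R with hgap
  have hgap0 : 0 < gap := by linarith
  -- The error `ε * G` must stay below `(α - 1) * gap`; dividing by `G + 1` covers the case `G = 0`.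
  refine ⟨(α - 1) * gap / (G + 1), by positivity, fun ε hε hεlt => ?_⟩
  have hθ : 0 < (α - 1) * gap - ε * G := by
    rw [lt_div_iff₀ (by linarith)] at hεlt
    linarith
  set θ := (α - 1) * gap - ε * G with hθdef
  set κ : ℝ := (Fintype.card 𝒰 + Fintype.card (𝒰 × 𝒳) : ℝ) / ε ^ 2 with hκ
  set a : ℕ → ℝ := fun n => 1 - κ / n with ha
  set d := Fintype.card ((𝒰 × 𝒳) × 𝒵) with hd
  have hM : ∀ n : ℕ, 0 < ⌊(2 : ℝ) ^ ((n : ℝ) * R)⌋₊ := fun n =>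
    Nat.floor_pos.2 (Real.one_le_rpow one_le_two (mul_nonneg n.cast_nonneg hR0))
  have halim : Tendsto a atTop (𝓝 1) := by
    have := (tendsto_const_div_atTop_nhds_zero_nat κ).const_sub 1
    rwa [sub_zero] at this
  have hT : ∀ᶠ n in atTop, 0 < a n ∧ TypicalProbGE p ε n (a n) := by
    filter_upwards [halim.eventually (lt_mem_nhds one_pos), eventually_gt_atTop 0] with n h1 h2
    refine ⟨h1, ?_⟩
    have := typicalProbGE hp h2 hε
    rwa [mul_comm, ← div_div] at this
  have hclim : Tendsto (fun n => (a n ^ 2)⁻¹ ^ α) atTop (𝓝 1) := by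
    have h1 := ((halim.pow 2).inv₀ (by norm_num)).rpow_const (p := α) (Or.inl (by norm_num))
    simpa using h1
  rw [Metric.tendsto_atTop']
  intro η hη
  -- `δ` and then `C` depend on `η` but not on `n`, so the decaying term disappears for fixed `C`
  -- and the upper bound tends to `1 + δ`.
  obtain ⟨δ, hδ, hδ1, hδη⟩ := exists_slack hα hη
  obtain ⟨C, hC0, hC⟩ := exists_add_rpow_le hα1 hδ
  have hlim : Tendsto (fun n : ℕ => (1 + δ) * (a n ^ 2)⁻¹ ^ α + α * C * ((a n ^ 2)⁻¹ ^ α *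
      ((((n + 1) ^ d : ℕ) : ℝ) ^ α * 2 ^ (n * -θ)))) atTop (𝓝 (1 + δ)) := by
    have := (hclim.const_mul (1 + δ)).add
      ((hclim.mul (tendsto_poly_mul_exp d α hθ)).const_mul (α * C))
    simpa using this
  have hev : ∀ᶠ n : ℕ in atTop, dist (binningExp 𝒰 n ⌊(2 : ℝ) ^ ((n : ℝ) * R)⌋₊ fun B =>
      tsallisDiv α (binnedLaw p W ε B) (idealLaw p W)) 0 < η := by
    filter_upwards [hT, hlim.eventually (gt_mem_nhds hδη)] with n hn hlt
    have h0 := binningExp_tsallisDiv_nonneg hp hW hα hn.1 hn.2 (hM n)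
    have h1 := binningExp_tsallisDiv_le hp hW hα hδ hC hn.1 hn.2 (hM n)
    set X := binningExp 𝒰 n ⌊(2 : ℝ) ^ ((n : ℝ) * R)⌋₊ fun B =>
      tsallisDiv α (binnedLaw p W ε B) (idealLaw p W) with hX
    have hMle : ((⌊(2 : ℝ) ^ ((n : ℝ) * R)⌋₊ : ℕ) : ℝ) ^ (α - 1) ≤
        2 ^ ((n : ℝ) * R * (α - 1)) := by
      rw [Real.rpow_mul two_pos.le _ (α - 1)]
      exact Real.rpow_le_rpow (Nat.cast_nonneg _) (Nat.floor_le (by positivity)) hα1.le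
    have ha0 := hn.1
    have h2 : ((⌊(2 : ℝ) ^ ((n : ℝ) * R)⌋₊ : ℕ) : ℝ) ^ (α - 1) *
        ∑ u : Fin n → 𝒰, ∑ z : Fin n → 𝒵, outMass p W ε u z ^ α *
          (∏ i, outZ p W (z i)) ^ (1 - α) ≤
        (a n ^ 2)⁻¹ ^ α * ((((n + 1) ^ d : ℕ) : ℝ) ^ α * 2 ^ (n * -θ)) := by
      refine (mul_le_mul_of_nonneg_left (hG ε n (a n) hn.1 hn.2) (by positivity)).trans ?_
      refine (mul_le_mul_of_nonneg_right hMle (by positivity)).trans (le_of_eq ?_)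
      rw [mul_left_comm, ← Real.rpow_add two_pos, mul_assoc]
      congr 3
      rw [hθdef, hgap]
      ring
    have h3 := mul_le_mul_of_nonneg_left h2 (by positivity : 0 ≤ α * C)
    have h4 : (1 - δ * (α - 1)) * (1 + (α - 1) * X) <
        (1 - δ * (α - 1)) * (1 + (α - 1) * η) := by linarith
    have h5 := lt_of_mul_lt_mul_left h4 hδ1.le
    rw [Real.dist_eq, sub_zero, abs_of_nonneg h0]
    exact lt_of_mul_lt_mul_left (by linarith) hα1.le
  obtain ⟨N, hN⟩ := eventually_atTop.1 hev
  exact ⟨N, fun n hn => hN n hn.le⟩
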